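/- Let $s_1,\dots,s_n$ be $n$ distinct points (sites) in $\mathbb{R}^2$ with appetites $A_1,\dots,A_n>0$. The stable-matching Voronoi diagram of these data is the subdivision of $\mathbb{R}^2$ into closed regions $C_1,\dots,C_n$ and $C_\emptyset$ (the unmatched points), each of which is the closure of its interior, such that the regions cover the plane and overlap only along their boundaries, $C_i$ has area $A_i$ for every $i$, and there is no blocking pair. Here a site $s_i$ and a point $p\in\mathbb{R}^2$ form a blocking pair if $p\notin C_i$, $d(p,s_i)<\max\{d(q,s_i): q\in C_i\}$, and either $p\in C_\emptyset$ or $d(p,s_i)<d(p,s_j)$ for some $j$ with $p\in C_j$. The faces of the diagram are the connected components of the regions; those of $C_\emptyset$ are called empty faces. An edge is a maximal (nondegenerate) line segment or circular arc on the common boundary of two faces, where, if two such circular arcs touch at a point that is not an endpoint, they are split there. A vertex is a point shared by more than one edge. **Theorem.** In the worst case, a stable-matching Voronoi diagram of $n$ point sites has $\Omega(n^2)$ faces, edges, and vertices, even when all sites have the same appetite. That is, there are a constant $c>0$ and an integer $N$ such that for every $n\ge N$ and every $a>0$ there are $n$ distinct sites in $\mathbb{R}^2$ whose stable-matching Voronoi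 diagram, with all appetites equal to $a$, has at least $cn^2$ faces (even without counting the empty faces), at least $cn^2$ edges, and at least $cn^2$ vertices. -/

import Mathlib

open scoped ENNReal

/-- The Euclidean plane. -/
abbrev Plane : Type := EuclideanSpace ℝ (Fin 2)

/-- `(s i, p)` is a blocking pair for the assignment `C` of regions: `p` is not in the region of
`s i`, the site `s i` is closer to `p` than to some point of its own region (i.e. `dist p (s i)` is
less than the maximal distance from `s i` to its region), and `p` is unmatched or is matched to a
site that is farther away from `p` than `s i`. -/
def IsBlockingPair {ι : Type*} (s : ι → Plane) (C : Option ι → Set Plane) (i : ι) (p : Plane) :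
    Prop :=
  p ∉ C (some i) ∧
  (∃ q ∈ C (some i), dist p (s i) < dist q (s i)) ∧
  (p ∈ C none ∨ ∃ j, p ∈ C (some j) ∧ dist p (s i) < dist p (s j))

/-- `C` is the stable-matching Voronoi diagram of the sites `s` with appetites `A`.
`C (some i)` is the region (stable cell) of the site `s i`, and `C none` is the region of the
unmatched points. The regions are closed sets; they are the closures of their interiors, so that no
region carries stray isolated points or curves (of area zero). -/
structure IsStableMatchingVoronoi {ι : Type*} (s : ι → Plane) (A : ι → ℝ)
    (C : Option ι → Set Plane) : Prop where
  cover : ⋃ o, C o = Set.univ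
  closure_interior : ∀ o, closure (interior (C o)) = C o
  inter_subset_frontier : ∀ o o', o ≠ o' → C o ∩ C o' ⊆ frontier (C o) ∩ frontier (C o')
  area : ∀ i, MeasureTheory.volume (C (some i)) = ENNReal.ofReal (A i)
  stable : ∀ i p, ¬ IsBlockingPair s C i p

/-- The connected components of a set: its maximal connected (nonempty) subsets. -/
def componentsOf (R : Set Plane) : Set (Set Plane) :=
  {F | ∃ x ∈ R, F = connectedComponentIn R x}

/-- The faces of the stable cells of the sites (the empty faces are not included). -/
def cellFaces {ι : Type*} (C : Option ι → Set Plane) : Set (Set Plane) :=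
  {F | ∃ i, F ∈ componentsOf (C (some i))}

/-- All the faces of the diagram: the faces of the stable cells and the empty faces. -/
def faces {ι : Type*} (C : Option ι → Set Plane) : Set (Set Plane) :=
  {F | ∃ o, F ∈ componentsOf (C o)}

/-- Nondegenerate line segments. -/
def IsSegment (E : Set Plane) : Prop :=
  ∃ a b : Plane, a ≠ b ∧ E = segment ℝ a b

/-- The point with angle `θ` on the circle with center `z` and radius `r`. -/
noncomputable def circlePoint (z : Plane) (r θ : ℝ) : Plane :=
  !₂[z 0 + r * Real.cos θ, z 1 + r * Real.sin θ]

/-- `E` is a nondegenerate circular arc (possibly a full circle), and `I` is obtained from it by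
deleting its two endpoints. A full circle has no distinguished endpoints; for it, `I` is the circle
with any one of its points deleted. -/
def IsArcWithInterior (E I : Set Plane) : Prop :=
  ∃ (z : Plane) (r α β : ℝ), 0 < r ∧ α < β ∧ β ≤ α + 2 * Real.pi ∧
    E = circlePoint z r '' Set.Icc α β ∧ I = circlePoint z r '' Set.Ioo α β

/-- The maximal circular arcs on the boundary of two faces. (Distinct faces of a diagram meet only
along their boundaries, so `F ∩ F'` is the common boundary of `F` and `F'`.) -/
def maximalArcs {ι : Type*} (C : Option ι → Set Plane) : Set (Set Plane) :=
  {E | ∃ F ∈ faces C, ∃ F' ∈ faces C, F ≠ F' ∧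
    Maximal (fun E => (∃ I, IsArcWithInterior E I) ∧ E ⊆ F ∩ F') E}

/-- The points where two maximal circular arcs touch that are not endpoints of these arcs.
(There are none if the sites are in general position.) -/
def tangencyPoints {ι : Type*} (C : Option ι → Set Plane) : Set Plane :=
  {p | ∃ E₁ ∈ maximalArcs C, ∃ E₂ ∈ maximalArcs C, E₁ ≠ E₂ ∧
    (∃ I, IsArcWithInterior E₁ I ∧ p ∈ I) ∧ (∃ I, IsArcWithInterior E₂ I ∧ p ∈ I)}

/-- The straight edges: the maximal line segments on the boundary of two faces. -/
def straightEdges {ι : Type*} (C : Option ι → Set Plane) : Set (Set Plane) :=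
  {E | ∃ F ∈ faces C, ∃ F' ∈ faces C, F ≠ F' ∧ Maximal (fun E => IsSegment E ∧ E ⊆ F ∩ F') E}

/-- The curved edges: the maximal circular arcs on the boundary of two faces, where arcs are split
at points of tangency. -/
def curvedEdges {ι : Type*} (C : Option ι → Set Plane) : Set (Set Plane) :=
  {E | ∃ F ∈ faces C, ∃ F' ∈ faces C, F ≠ F' ∧
    Maximal (fun E => (∃ I, IsArcWithInterior E I ∧ Disjoint I (tangencyPoints C)) ∧
      E ⊆ F ∩ F') E}

/-- The edges of the diagram. -/
def edges {ι : Type*} (C : Option ι → Set Plane) : Set (Set Plane) :=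
  straightEdges C ∪ curvedEdges C

/-- The vertices of the diagram: the points shared by more than one edge. -/
def vertices {ι : Type*} (C : Option ι → Set Plane) : Set Plane :=
  {v | ∃ E₁ ∈ edges C, ∃ E₂ ∈ edges C, E₁ ≠ E₂ ∧ v ∈ E₁ ∧ v ∈ E₂}

/-!
Equally spaced sites on a vertical line are given discs of a common radius `r`, of which a site
keeps the part at less than half the spacing from its height. Next to the line at distance `r` from
the sites, consecutive discs leave a notch between them. A second group of sites is packed so
densely in a row far above the first one that the discs around its middle sites contain all notches
while the sites of the column win inside their own discs. There the cells of the row are thin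
vertical strips, which the discs of the column cut into pieces, one in every notch. Each piece is a
face with its own vertical edge, circular edge and corner, so there is a quadratic grid of them.

Discs for which all cells have the same prescribed area are obtained by maximizing the sum of the
radii under the constraint that no cell is too large. A cluster of sites at either end of the column
and the outer sites of the row fill the surrounding area, which forces the radii in the middle to be
large.
-/

open MeasureTheory Set Filter Topology Metric

section Coordinates

namespace Plane

theorem dist_sq (p q : Plane) : dist p q ^ 2 = (p 0 - q 0) ^ 2 + (p 1 - q 1) ^ 2 := by
  rw [EuclideanSpace.dist_sq_eq, Fin.sum_univ_two, Real.dist_eq, Real.dist_eq, sq_abs, sq_abs]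

theorem dist_lt_iff {p q : Plane} {d : ℝ} (hd : 0 ≤ d) : dist p q < d ↔
    (p 0 - q 0) ^ 2 + (p 1 - q 1) ^ 2 < d ^ 2 := by
  rw [← dist_sq, sq_lt_sq₀ dist_nonneg hd]

theorem lt_dist_iff {p q : Plane} {d : ℝ} (hd : 0 ≤ d) : d < dist p q ↔
    d ^ 2 < (p 0 - q 0) ^ 2 + (p 1 - q 1) ^ 2 := by
  rw [← dist_sq, sq_lt_sq₀ hd dist_nonneg]

theorem le_dist_iff {p q : Plane} {d : ℝ} (hd : 0 ≤ d) : d ≤ dist p q ↔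
    d ^ 2 ≤ (p 0 - q 0) ^ 2 + (p 1 - q 1) ^ 2 := by
  rw [← not_lt, dist_lt_iff hd, not_lt]

theorem dist_le_dist_iff_abs_sub_le (c : Fin 2) {p q q' : Plane} (h : q (1 - c) = q' (1 - c)) :
    dist p q ≤ dist p q' ↔ |p c - q c| ≤ |p c - q' c| := by
  rw [← sq_le_sq, ← sq_le_sq₀ dist_nonneg dist_nonneg, dist_sq, dist_sq]
  fin_cases c <;> simp_all

theorem dist_lt_dist_iff_abs_sub_lt (c : Fin 2) {p q q' : Plane} (h : q (1 - c) = q' (1 - c)) :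
    dist p q < dist p q' ↔ |p c - q c| < |p c - q' c| :=
  lt_iff_lt_of_le_iff_le (dist_le_dist_iff_abs_sub_le c h.symm)

theorem dist_lt_dist_of_le_of_lt (c : Fin 2) {p q q' : Plane} (h : q (1 - c) = q' (1 - c))
    (hpq : p c ≤ q c) (hqq' : q c < q' c) : dist p q < dist p q' := by
  rw [dist_lt_dist_iff_abs_sub_lt c h, abs_sub_comm, abs_sub_comm (p c),
    abs_of_nonneg (sub_nonneg.2 hpq), abs_of_nonneg (sub_nonneg.2 (hpq.trans hqq'.le))]
  linarith

theorem dist_lt_dist_of_lt_of_le (c : Fin 2) {p q q' : Plane} (h : q (1 - c) = q' (1 - c))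
    (hq'q : q' c < q c) (hqp : q c ≤ p c) : dist p q < dist p q' := by
  rw [dist_lt_dist_iff_abs_sub_lt c h, abs_of_nonneg (sub_nonneg.2 hqp),
    abs_of_nonneg (sub_nonneg.2 (hq'q.le.trans hqp))]
  linarith

theorem dist_eq_abs_sub (c : Fin 2) {p q : Plane} (h : p (1 - c) = q (1 - c)) :
    dist p q = |p c - q c| := by
  rw [← sq_eq_sq₀ dist_nonneg (abs_nonneg _), sq_abs, dist_sq]
  fin_cases c <;> simp_all

theorem abs_sub_le_dist (p q : Plane) (c : Fin 2) : |p c - q c| ≤ dist p q :=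
  PiLp.dist_apply_le p q c

end Plane

theorem volume_setOf_forall_mem {ι : Type*} [Fintype ι] (S : ι → Set ℝ) :
    volume {p : EuclideanSpace ℝ ι | ∀ i, p i ∈ S i} = ∏ i, volume (S i) := by
  have hpre : {p : EuclideanSpace ℝ ι | ∀ i, p i ∈ S i} =
      (MeasurableEquiv.toLp 2 (ι → ℝ)).symm ⁻¹' Set.pi univ S := by
    ext p
    simp
  rw [hpre, (EuclideanSpace.volume_preserving_symm_measurableEquiv_toLp ι).measure_preimage_equiv,
    volume_pi_pi]

theorem Plane.volume_prod (S S' : Set ℝ) :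
    volume {p : Plane | p 0 ∈ S ∧ p 1 ∈ S'} = volume S * volume S' := by
  simpa [Fin.forall_fin_two, Fin.prod_univ_two] using volume_setOf_forall_mem ![S, S']

theorem Plane.volume_ball (z : Plane) {r : ℝ} (hr : 0 ≤ r) :
    volume (ball z r) = ENNReal.ofReal (Real.pi * r ^ 2) := by
  rw [EuclideanSpace.volume_ball_fin_two, ← ENNReal.ofReal_pow hr,
    ← ENNReal.ofReal_mul (sq_nonneg r), mul_comm]

theorem Plane.volume_ball_inter_slab_le (z : Plane) (c : Fin 2) {D u w : ℝ} (hD : 0 ≤ D) :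
    volume (ball z D ∩ {p | p c ∈ Icc u (u + w)}) ≤ ENNReal.ofReal (2 * D * w) := by
  have hball : ∀ p ∈ ball z D, ∀ i, p i ∈ Ioo (z i - D) (z i + D) := fun p hp i => by
    have := (abs_sub_le_dist p z i).trans_lt hp
    rw [abs_sub_lt_iff] at this
    constructor <;> linarith
  have hvol : volume (Ioo (z (1 - c) - D) (z (1 - c) + D)) * volume (Icc u (u + w)) =
      ENNReal.ofReal (2 * D * w) := by
    rw [Real.volume_Ioo, Real.volume_Icc, ← ENNReal.ofReal_mul (by linarith)]
    congr 1
    ring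
  fin_cases c
  · refine (measure_mono fun p hp => ?_).trans_eq
      ((volume_prod _ _).trans ((mul_comm _ _).trans hvol))
    exact ⟨hp.2, hball p hp.1 1⟩
  · refine (measure_mono fun p hp => ?_).trans_eq ((volume_prod _ _).trans hvol)
    exact ⟨hball p hp.1 0, hp.2⟩

end Coordinates

section Cells

variable {X ι κ : Type*} [PseudoMetricSpace X] {s : ι → X} {ρ : ι → ℝ} {i j : ι} {p : X}

/-- The interior of the cell of `s i` when each site `s j` is matched up to the radius `ρ j`: the
points within reach of `s i` to which no other site within reach is at least as close. -/
def openCell (s : ι → X) (ρ : ι → ℝ) (i : ι) : Set X :=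
  {p | dist p (s i) < ρ i ∧ ∀ j, j ≠ i → ρ j < dist p (s j) ∨ dist p (s i) < dist p (s j)}

/-- The interior of the unmatched region when each site `s j` is matched up to the radius `ρ j`:
the points that are out of reach of all sites. -/
def openUnmatched (s : ι → X) (ρ : ι → ℝ) : Set X :=
  {p | ∀ j, ρ j < dist p (s j)}

/-- The diagram in which each site `s i` is matched up to the radius `ρ i`. -/
def radiiDiagram (s : ι → X) (ρ : ι → ℝ) : Option ι → Set X
  | none => closure (openUnmatched s ρ)
  | some i => closure (openCell s ρ i)

/-- The circles and the bisectors, which together contain all boundaries of the diagram with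
radii `ρ`. -/
def walls (s : ι → X) (ρ : ι → ℝ) : Set X :=
  (⋃ i, sphere (s i) (ρ i)) ∪ ⋃ i, ⋃ j, ⋃ (_ : i ≠ j), {p | dist p (s i) = dist p (s j)}

theorem lt_dist_of_mem_openCell (h : p ∈ openCell s ρ i) (hj : j ≠ i)
    (hd : dist p (s j) ≤ dist p (s i)) : ρ j < dist p (s j) :=
  (h.2 j hj).resolve_right hd.not_gt

theorem dist_lt_dist_of_mem_openCell (h : p ∈ openCell s ρ i) (hj : j ≠ i) (hρ : ρ i ≤ ρ j) :
    dist p (s i) < dist p (s j) :=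
  (h.2 j hj).elim (h.1.trans_le hρ).trans id

theorem openCell_subset_ball (s : ι → X) (ρ : ι → ℝ) (i : ι) :
    openCell s ρ i ⊆ ball (s i) (ρ i) := fun _ h => h.1

theorem openCell_mono {ρ' : ι → ℝ} (hi : ρ i ≤ ρ' i) (h : ∀ j, j ≠ i → ρ' j ≤ ρ j) :
    openCell s ρ i ⊆ openCell s ρ' i := fun _ hp =>
  ⟨hp.1.trans_le hi, fun j hj => (hp.2 j hj).imp_left (h j hj).trans_lt⟩

theorem openCell_eq_empty_of_nonpos (hi : ρ i ≤ 0) : openCell s ρ i = ∅ :=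
  subset_empty_iff.1 ((openCell_subset_ball s ρ i).trans_eq (ball_eq_empty.2 hi))

theorem disjoint_openCell (s : ι → X) (ρ : ι → ℝ) (hij : i ≠ j) :
    Disjoint (openCell s ρ i) (openCell s ρ j) := by
  refine Set.disjoint_left.2 fun p hi hj => ?_
  rcases le_total (dist p (s i)) (dist p (s j)) with h | h
  · exact (lt_dist_of_mem_openCell hj hij h).not_gt hi.1
  · exact (lt_dist_of_mem_openCell hi hij.symm h).not_gt hj.1

theorem disjoint_openCell_openUnmatched (s : ι → X) (ρ : ι → ℝ) (i : ι) :
    Disjoint (openCell s ρ i) (openUnmatched s ρ) :=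
  Set.disjoint_left.2 fun _ hi h => (h i).not_gt hi.1

theorem isOpen_openCell [Finite ι] (s : ι → X) (ρ : ι → ℝ) (i : ι) : IsOpen (openCell s ρ i) := by
  simp only [openCell, Set.ofPred_and, Set.ofPred_forall, Set.ofPred_or]
  refine (isOpen_lt (by fun_prop) (by fun_prop)).inter ?_
  refine isOpen_iInter_of_finite fun j => isOpen_iInter_of_finite fun _ => IsOpen.union ?_ ?_
  · exact isOpen_lt (by fun_prop) (by fun_prop)
  · exact isOpen_lt (by fun_prop) (by fun_prop)

theorem isOpen_openUnmatched [Finite ι] (s : ι → X) (ρ : ι → ℝ) : IsOpen (openUnmatched s ρ) := by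
  simp only [openUnmatched, Set.ofPred_forall]
  exact isOpen_iInter_of_finite fun j => isOpen_lt (by fun_prop) (by fun_prop)

theorem exists_mem_openCell [Finite ι] (hp : p ∉ walls s ρ) (hj : dist p (s j) < ρ j) :
    ∃ i, p ∈ openCell s ρ i := by
  have hcircle : ∀ i, dist p (s i) ≠ ρ i := fun i h => hp (Or.inl (mem_iUnion.2 ⟨i, h⟩))
  have hbisector : ∀ i j, i ≠ j → dist p (s i) ≠ dist p (s j) := fun i j h h' =>
    hp (Or.inr (by simp only [mem_iUnion]; exact ⟨i, j, h, h'⟩))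
  obtain ⟨i, hi, hmin⟩ := Set.exists_min_image {i | dist p (s i) < ρ i} (fun i => dist p (s i))
    (Set.toFinite _) ⟨j, hj⟩
  refine ⟨i, hi, fun k hk => or_iff_not_imp_left.2 fun h => ?_⟩
  exact (hmin k ((not_lt.1 h).lt_of_ne (hcircle k))).lt_of_ne (hbisector i k hk.symm)

theorem mem_openUnmatched_or_exists_mem_openCell [Finite ι] (hp : p ∉ walls s ρ) :
    p ∈ openUnmatched s ρ ∨ ∃ i, p ∈ openCell s ρ i := by
  by_cases! h : ∃ j, dist p (s j) < ρ j
  · exact Or.inr (exists_mem_openCell hp h.choose_spec)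
  · exact Or.inl fun j => (h j).lt_of_ne fun h' => hp (Or.inl (mem_iUnion.2 ⟨j, h'.symm⟩))

theorem frontier_openCell_subset_walls [Finite ι] (s : ι → X) (ρ : ι → ℝ) (i : ι) :
    frontier (openCell s ρ i) ⊆ walls s ρ := by
  intro p hp
  by_contra hw
  have hopen := isOpen_openCell s ρ
  rw [(hopen i).frontier_eq] at hp
  rcases mem_openUnmatched_or_exists_mem_openCell hw with h | ⟨j, h⟩
  · exact ((disjoint_openCell_openUnmatched s ρ i).closure_left
      (isOpen_openUnmatched s ρ)).notMem_of_mem_left hp.1 h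
  · rcases eq_or_ne i j with rfl | hij
    · exact hp.2 h
    · exact ((disjoint_openCell s ρ hij).closure_left (hopen j)).notMem_of_mem_left hp.1 h

theorem dist_le_of_mem_radiiDiagram (hp : p ∈ radiiDiagram s ρ (some i)) : dist p (s i) ≤ ρ i :=
  closure_minimal (t := {p | dist p (s i) ≤ ρ i}) (fun _ h => h.1.le)
    (isClosed_le (by fun_prop) (by fun_prop)) hp

theorem dist_le_dist_of_mem_radiiDiagram (hp : p ∈ radiiDiagram s ρ (some i))
    (hj : dist p (s j) < ρ j) : dist p (s i) ≤ dist p (s j) := by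
  rcases eq_or_ne j i with rfl | hij
  · rfl
  have hsub : closure (openCell s ρ i) ⊆
      {p | ρ j ≤ dist p (s j)} ∪ {p | dist p (s i) ≤ dist p (s j)} :=
    closure_minimal (fun p h => (h.2 j hij).imp le_of_lt le_of_lt)
      ((isClosed_le (by fun_prop) (by fun_prop)).union (isClosed_le (by fun_prop) (by fun_prop)))
  exact (hsub hp).resolve_left (not_le.2 hj)

theorem le_dist_of_mem_radiiDiagram_none (i : ι) (hp : p ∈ radiiDiagram s ρ none) :
    ρ i ≤ dist p (s i) :=
  closure_minimal (t := {p | ρ i ≤ dist p (s i)}) (fun _ h => (h i).le)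
    (isClosed_le (by fun_prop) (by fun_prop)) hp

theorem openCell_comp_equiv (s : ι → X) (ρ : ι → ℝ) (e : κ ≃ ι) (k : κ) :
    openCell (s ∘ e) (ρ ∘ e) k = openCell s ρ (e k) := by
  ext p
  simp only [openCell, Function.comp_apply, mem_ofPred_eq, ← e.forall_congr_right (q := fun j =>
    j ≠ e k → ρ j < dist p (s j) ∨ dist p (s (e k)) < dist p (s j)), e.injective.ne_iff]

theorem openUnmatched_comp_equiv (s : ι → X) (ρ : ι → ℝ) (e : κ ≃ ι) :
    openUnmatched (s ∘ e) (ρ ∘ e) = openUnmatched s ρ := by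
  ext p
  exact e.forall_congr_right (q := fun j => ρ j < dist p (s j))

theorem radiiDiagram_comp_equiv (s : ι → X) (ρ : ι → ℝ) (e : κ ≃ ι) :
    radiiDiagram (s ∘ e) (ρ ∘ e) = radiiDiagram s ρ ∘ Option.map e := by
  funext o
  cases o with
  | none => exact congrArg closure (openUnmatched_comp_equiv s ρ e)
  | some k => exact congrArg closure (openCell_comp_equiv s ρ e k)

end Cells

section Measure

variable {X ι : Type*} [PseudoMetricSpace X] [MeasurableSpace X] {μ : Measure X} {s : ι → X}
  {ρ : ι → ℝ}

theorem exists_lt_measure_ball (x : X) {b : ℝ≥0∞} (hb : b < μ univ) :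
    ∃ R : ℝ, 0 ≤ R ∧ b < μ (ball x R) := by
  have hmono : Monotone fun n : ℕ => ball x (n : ℝ) :=
    fun _ _ h => ball_subset_ball (Nat.cast_le.2 h)
  have htendsto := tendsto_measure_iUnion_atTop (μ := μ) hmono
  rw [iUnion_ball_nat] at htendsto
  obtain ⟨n, hn⟩ := (htendsto.eventually (lt_mem_nhds hb)).exists
  exact ⟨n, n.cast_nonneg, hn⟩

theorem measure_ball_le_sum_openCell [Fintype ι] (hwalls : μ (walls s ρ) = 0) (i : ι) :
    μ (ball (s i) (ρ i)) ≤ ∑ j, μ (openCell s ρ j) := by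
  have hsub : ball (s i) (ρ i) ⊆ walls s ρ ∪ ⋃ j, openCell s ρ j := fun p hp =>
    or_iff_not_imp_left.2 fun hw => mem_iUnion.2 (exists_mem_openCell hw hp)
  calc μ (ball (s i) (ρ i)) ≤ μ (walls s ρ) + μ (⋃ j, openCell s ρ j) :=
        (measure_mono hsub).trans (measure_union_le _ _)
    _ ≤ ∑ j, μ (openCell s ρ j) := by
        rw [hwalls, zero_add]
        exact measure_iUnion_fintype_le _ _

variable [OpensMeasurableSpace X]

theorem sum_measure_openCell_le [Finite ι] (G : Finset ι) {z : X} {D η : ℝ}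
    (hG : ∀ g ∈ G, ρ g ≤ D) (hη : ∀ g ∈ G, dist (s g) z ≤ η) :
    ∑ g ∈ G, μ (openCell s ρ g) ≤ μ (ball z (D + η)) := by
  rw [← measure_biUnion_finset (fun i _ j _ hij => disjoint_openCell s ρ hij)
    fun i _ => (isOpen_openCell s ρ i).measurableSet]
  exact measure_mono (iUnion₂_subset fun g hg => (openCell_subset_ball s ρ g).trans
    (ball_subset_ball' (add_le_add (hG g hg) (hη g hg))))

section Continuity

variable [ProperSpace X] [IsFiniteMeasureOnCompacts μ]

theorem continuousAt_measure_openCell [Finite ι] (hwalls : μ (walls s ρ) = 0) (i : ι) :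
    ContinuousAt (fun ρ' => μ (openCell s ρ' i)) ρ := by
  have := Fintype.ofFinite ι
  refine tendsto_measure_of_ae_tendsto_indicator (B := ball (s i) (ρ i + 1)) _
    (isOpen_openCell s ρ i).measurableSet (fun ρ' => (isOpen_openCell s ρ' i).measurableSet)
    measurableSet_ball measure_ball_lt_top.ne ?_ ?_
  · have hlt : ∀ᶠ ρ' : ι → ℝ in 𝓝 ρ, ρ' i < ρ i + 1 :=
      (continuous_apply i).continuousAt.eventually_lt continuousAt_const (by simp)
    filter_upwards [hlt] with ρ' h
    exact (openCell_subset_ball s ρ' i).trans (ball_subset_ball h.le)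
  · filter_upwards [compl_mem_ae_iff.2 hwalls] with p hp
    have hcircle : ∀ j, dist p (s j) ≠ ρ j := fun i h => hp (Or.inl (mem_iUnion.2 ⟨i, h⟩))
    have hstable : ∀ j, ∀ᶠ ρ' : ι → ℝ in 𝓝 ρ,
        (dist p (s j) < ρ' j ↔ dist p (s j) < ρ j) ∧
          (ρ' j < dist p (s j) ↔ ρ j < dist p (s j)) := by
      intro j
      have hc : ContinuousAt (fun ρ' : ι → ℝ => ρ' j) ρ := (continuous_apply j).continuousAt
      rcases (hcircle j).lt_or_gt with h | h
      · filter_upwards [continuousAt_const.eventually_lt hc h] with ρ' h'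
        exact ⟨iff_of_true h' h, iff_of_false h'.not_gt h.not_gt⟩
      · filter_upwards [hc.eventually_lt continuousAt_const h] with ρ' h'
        exact ⟨iff_of_false h'.not_gt h.not_gt, iff_of_true h' h⟩
    filter_upwards [eventually_all.2 hstable] with ρ' h
    simp only [openCell, mem_ofPred_eq, h]

theorem exists_update_measure_openCell_le [Finite ι] [DecidableEq ι] {A : ι → ℝ≥0∞} {i : ι} {R : ℝ}
    (hwalls : μ (walls s ρ) = 0) (hle : ∀ j, μ (openCell s ρ j) ≤ A j)
    (hlt : μ (openCell s ρ i) < A i) (hR : ρ i < R) :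
    ∃ x ∈ Ioo (ρ i) R, ∀ j, μ (openCell s (Function.update ρ i x) j) ≤ A j := by
  have hcont : ContinuousAt (fun x => μ (openCell s (Function.update ρ i x) i)) (ρ i) :=
    ContinuousAt.comp (g := fun ρ' => μ (openCell s ρ' i)) (f := fun x => Function.update ρ i x)
      (by simpa using continuousAt_measure_openCell hwalls i) (by fun_prop)
  have hnear : ∀ᶠ x in 𝓝[>] (ρ i), μ (openCell s (Function.update ρ i x) i) < A i :=
    (hcont.eventually_lt continuousAt_const (by simpa using hlt)).filter_mono nhdsWithin_le_nhds
  obtain ⟨x, hx, hxR⟩ := (hnear.and (Ioo_mem_nhdsGT hR)).exists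
  refine ⟨x, hxR, fun j => ?_⟩
  rcases eq_or_ne j i with rfl | hj
  · exact hx.le
  · refine (measure_mono (openCell_mono (by simp [hj]) fun k _ => ?_)).trans (hle j)
    exact le_update_self_iff.2 hxR.1.le k

/- Among all radii for which no cell is too large, take those with maximal sum: a cell that is
still too small could be enlarged at the expense of the other cells. -/
theorem exists_radii [Fintype ι] (hwalls : ∀ ρ, μ (walls s ρ) = 0) {A : ι → ℝ≥0∞}
    (hA : ∑ i, A i < μ univ) : ∃ ρ : ι → ℝ, ∀ i, μ (openCell s ρ i) = A i := by
  classical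
  choose R hR0 hR using fun i => exists_lt_measure_ball (s i) hA
  let S : Set (ι → ℝ) := Icc 0 R ∩ ⋂ i, {ρ | μ (openCell s ρ i) ≤ A i}
  have hScompact : IsCompact S := isCompact_Icc.inter_right <| isClosed_iInter fun i =>
    isClosed_le (continuous_iff_continuousAt.2 fun ρ => continuousAt_measure_openCell (hwalls ρ) i)
      continuous_const
  have h0S : (0 : ι → ℝ) ∈ S := ⟨⟨le_rfl, hR0⟩, mem_iInter.2 fun i => by
    simp [openCell_eq_empty_of_nonpos (ρ := 0) (i := i) le_rfl]⟩
  obtain ⟨ρ, hρ, hmax⟩ := hScompact.exists_isMaxOn ⟨0, h0S⟩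
    (f := fun ρ : ι → ℝ => ∑ i, ρ i) (by fun_prop)
  have hle : ∀ i, μ (openCell s ρ i) ≤ A i := mem_iInter.1 hρ.2
  refine ⟨ρ, fun i => (hle i).antisymm (not_lt.1 fun hlt => ?_)⟩
  have hiR : ρ i < R i := (hρ.1.2 i).lt_of_ne fun h => by
    refine (hR i).not_ge ?_
    rw [← h]
    exact (measure_ball_le_sum_openCell (hwalls ρ) i).trans (Finset.sum_le_sum fun j _ => hle j)
  obtain ⟨x, hx, hxle⟩ := exists_update_measure_openCell_le (hwalls ρ) hle hlt hiR
  have hxρ : ρ ≤ Function.update ρ i x := le_update_self_iff.2 hx.1.le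
  have hxS : Function.update ρ i x ∈ S := ⟨⟨hρ.1.1.trans hxρ, update_le_iff.2
    ⟨hx.2.le, fun j _ => hρ.1.2 j⟩⟩, mem_iInter.2 hxle⟩
  refine (hmax hxS).not_gt (Finset.sum_lt_sum (fun j _ => hxρ j) ⟨i, Finset.mem_univ i, ?_⟩)
  simpa using hx.1

end Continuity

end Measure

section Glue

variable {X ι κ : Type*} [PseudoMetricSpace X] {s₁ : ι → X} {s₂ : κ → X} {ρ₁ : ι → ℝ}
  {ρ₂ : κ → ℝ}

theorem openCell_elim_inl (hsep : ∀ i p, dist p (s₁ i) < ρ₁ i → ∀ k, dist p (s₁ i) < dist p (s₂ k))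
    (i : ι) : openCell (Sum.elim s₁ s₂) (Sum.elim ρ₁ ρ₂) (.inl i) = openCell s₁ ρ₁ i := by
  ext p
  constructor
  · rintro ⟨hi, hother⟩
    exact ⟨hi, fun j hj => hother (.inl j) (Sum.inl_injective.ne hj)⟩
  · rintro ⟨hi, hother⟩
    refine ⟨hi, Sum.rec (fun j hj => hother j (ne_of_apply_ne Sum.inl hj)) fun k _ => ?_⟩
    exact Or.inr (hsep i p hi k)

theorem openCell_elim_inr
    (hsep : ∀ i p, dist p (s₁ i) ≤ ρ₁ i → ∀ k, dist p (s₁ i) < dist p (s₂ k)) (k : κ) :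
    openCell (Sum.elim s₁ s₂) (Sum.elim ρ₁ ρ₂) (.inr k) =
      openCell s₂ ρ₂ k ∩ openUnmatched s₁ ρ₁ := by
  ext p
  constructor
  · rintro ⟨hk, hother⟩
    refine ⟨⟨hk, fun j hj => hother (.inr j) (Sum.inr_injective.ne hj)⟩, fun i => ?_⟩
    by_contra! hle
    exact (lt_dist_of_mem_openCell ⟨hk, hother⟩ Sum.inl_ne_inr (hsep i p hle k).le).not_ge hle
  · rintro ⟨⟨hk, hother⟩, hun⟩
    exact ⟨hk, Sum.rec (fun j _ => Or.inl (hun j)) fun j hj =>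
      hother j (ne_of_apply_ne Sum.inr hj)⟩

variable [MeasurableSpace X] [OpensMeasurableSpace X] {μ : Measure X}

theorem measure_openCell_elim [Finite κ]
    (hsep : ∀ i p, dist p (s₁ i) ≤ ρ₁ i → ∀ k, dist p (s₁ i) < dist p (s₂ k)) (o : ι ⊕ κ) :
    μ (openCell (Sum.elim s₁ s₂) (Sum.elim ρ₁ ρ₂) o) =
      o.elim (fun i => μ (openCell s₁ ρ₁ i))
        fun k => μ.restrict (openUnmatched s₁ ρ₁) (openCell s₂ ρ₂ k) := by
  rcases o with i | k
  · rw [openCell_elim_inl fun i p hp => hsep i p hp.le]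
    rfl
  · rw [openCell_elim_inr hsep, ← Measure.restrict_apply (isOpen_openCell _ _ _).measurableSet]
    rfl

theorem measure_openUnmatched_eq_top [Finite ι] [ProperSpace X] [IsFiniteMeasureOnCompacts μ]
    (hμ : μ univ = ∞) (s : ι → X) (ρ : ι → ℝ) : μ (openUnmatched s ρ) = ∞ := by
  have := Fintype.ofFinite ι
  have hsub : (openUnmatched s ρ)ᶜ ⊆ ⋃ i, closedBall (s i) (ρ i) := fun p hp => by
    simpa [openUnmatched] using hp
  have hcompl : μ (openUnmatched s ρ)ᶜ < ∞ :=
    (measure_mono hsub).trans_lt ((measure_iUnion_fintype_le _ _).trans_lt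
      (ENNReal.sum_lt_top.2 fun i _ => measure_closedBall_lt_top))
  have hadd := measure_add_measure_compl (μ := μ) (isOpen_openUnmatched s ρ).measurableSet
  rw [hμ] at hadd
  exact (ENNReal.add_eq_top.1 hadd).resolve_right hcompl.ne

end Glue

section Diagram

theorem closure_interior_closure_of_isOpen {X : Type*} [TopologicalSpace X] {U : Set X}
    (hU : IsOpen U) : closure (interior (closure U)) = closure U :=
  (closure_minimal interior_subset isClosed_closure).antisymm
    (closure_mono (interior_maximal subset_closure hU))

theorem closure_subset_frontier_closure_of_disjoint {X : Type*} [TopologicalSpace X]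
    {U V : Set X} (hV : IsOpen V) (h : Disjoint U V) :
    closure U ∩ closure V ⊆ frontier (closure U) := by
  rintro p ⟨hU, hV'⟩
  rw [isClosed_closure.frontier_eq]
  exact ⟨hU, fun hi => (((h.closure_left hV).mono_left interior_subset).closure_right
    isOpen_interior).notMem_of_mem_left hi hV'⟩

theorem addHaar_setOf_dist_eq {E : Type*} [NormedAddCommGroup E] [InnerProductSpace ℝ E]
    [FiniteDimensional ℝ E] [MeasurableSpace E] [BorelSpace E] (μ : Measure E)
    [μ.IsAddHaarMeasure] {a b : E} (h : a ≠ b) : μ {p | dist p a = dist p b} = 0 := by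
  have hset : {p | dist p a = dist p b} = (AffineSubspace.perpBisector a b : Set E) := by
    ext p
    simp [AffineSubspace.mem_perpBisector_iff_dist_eq]
  rw [hset]
  exact Measure.addHaar_affineSubspace _ _ (AffineSubspace.perpBisector_eq_top.not.2 h)

theorem addHaar_walls {E ι : Type*} [NormedAddCommGroup E] [InnerProductSpace ℝ E]
    [FiniteDimensional ℝ E] [Nontrivial E] [MeasurableSpace E] [BorelSpace E] (μ : Measure E)
    [μ.IsAddHaarMeasure] [Countable ι] {s : ι → E} (hs : Function.Injective s) (ρ : ι → ℝ) :
    μ (walls s ρ) = 0 :=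
  measure_union_null (measure_iUnion_null fun _ => Measure.addHaar_sphere _ _ _) <|
    measure_iUnion_null fun _ => measure_iUnion_null fun _ => measure_iUnion_null fun h =>
      addHaar_setOf_dist_eq μ (hs.ne h)

variable {ι κ : Type*} {s : ι → Plane} {ρ : ι → ℝ}

theorem iUnion_radiiDiagram [Finite ι] (hs : Function.Injective s) :
    ⋃ o, radiiDiagram s ρ o = univ := by
  have hclosed : IsClosed (⋃ o, radiiDiagram s ρ o) :=
    isClosed_iUnion_of_finite fun o => by cases o <;> exact isClosed_closure
  have hdense : Dense (walls s ρ)ᶜ := interior_eq_empty_iff_dense_compl.1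
    (Measure.interior_eq_empty_of_null (addHaar_walls volume hs ρ))
  rw [← hclosed.closure_eq, ← dense_iff_closure_eq]
  refine hdense.mono fun p hp => mem_iUnion.2 ?_
  rcases mem_openUnmatched_or_exists_mem_openCell hp with h | ⟨i, h⟩
  · exact ⟨none, subset_closure h⟩
  · exact ⟨some i, subset_closure h⟩

theorem not_isBlockingPair_radiiDiagram (i : ι) (p : Plane) :
    ¬ IsBlockingPair s (radiiDiagram s ρ) i p := by
  rintro ⟨-, ⟨q, hq, hpq⟩, h⟩
  have hpi : dist p (s i) < ρ i := hpq.trans_le (dist_le_of_mem_radiiDiagram hq)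
  rcases h with h | ⟨j, h, hij⟩
  · exact (le_dist_of_mem_radiiDiagram_none i h).not_gt hpi
  · exact (dist_le_dist_of_mem_radiiDiagram h hpi).not_gt hij

theorem isStableMatchingVoronoi_radiiDiagram [Finite ι] {A : ι → ℝ} (hs : Function.Injective s)
    (hA : ∀ i, volume (openCell s ρ i) = ENNReal.ofReal (A i)) :
    IsStableMatchingVoronoi s A (radiiDiagram s ρ) := by
  let U : Option ι → Set Plane := fun o => o.elim (openUnmatched s ρ) (openCell s ρ)
  have hU : ∀ o, IsOpen (U o) :=
    Option.rec (isOpen_openUnmatched s ρ) (isOpen_openCell s ρ)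
  have hC : ∀ o, radiiDiagram s ρ o = closure (U o) := Option.rec rfl fun _ => rfl
  have hdisj : ∀ o o', o ≠ o' → Disjoint (U o) (U o') := by
    rintro (_ | i) (_ | j) h
    · exact absurd rfl h
    · exact (disjoint_openCell_openUnmatched s ρ j).symm
    · exact disjoint_openCell_openUnmatched s ρ i
    · exact disjoint_openCell s ρ (ne_of_apply_ne some h)
  refine ⟨iUnion_radiiDiagram hs, fun o => ?_, fun o o' h => ?_, fun i => ?_,
    not_isBlockingPair_radiiDiagram⟩
  · rw [hC, closure_interior_closure_of_isOpen (hU o)]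
  · rw [hC, hC]
    refine subset_inter (closure_subset_frontier_closure_of_disjoint (hU o') (hdisj o o' h)) ?_
    rw [inter_comm]
    exact closure_subset_frontier_closure_of_disjoint (hU o) (hdisj o o' h).symm
  · rw [← hA i]
    exact measure_congr (closure_ae_eq_of_null_frontier (measure_mono_null
      (frontier_openCell_subset_walls s ρ i) (addHaar_walls volume hs ρ)))

theorem faces_comp {C : Option ι → Set Plane} {g : Option κ → Option ι}
    (hg : Function.Surjective g) : faces (C ∘ g) = faces C := by
  ext F
  exact (hg.exists (p := fun o => F ∈ componentsOf (C o))).symm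

theorem cellFaces_comp_map {C : Option ι → Set Plane} {f : κ → ι} (hf : Function.Surjective f) :
    cellFaces (C ∘ Option.map f) = cellFaces C := by
  ext F
  exact (hf.exists (p := fun i => F ∈ componentsOf (C (some i)))).symm

theorem edges_comp {C : Option ι → Set Plane} {g : Option κ → Option ι}
    (hg : Function.Surjective g) : edges (C ∘ g) = edges C := by
  simp only [edges, straightEdges, curvedEdges, tangencyPoints, maximalArcs, faces_comp hg]

theorem vertices_comp {C : Option ι → Set Plane} {g : Option κ → Option ι}
    (hg : Function.Surjective g) : vertices (C ∘ g) = vertices C := by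
  simp only [vertices, edges_comp hg]

end Diagram

section Planar

theorem continuous_toPlane {α : Type*} [TopologicalSpace α] {f g : α → ℝ} (hf : Continuous f)
    (hg : Continuous g) : Continuous fun a => (!₂[f a, g a] : Plane) :=
  (PiLp.continuous_toLp 2 _).comp (continuous_pi (Fin.forall_fin_two.2 ⟨hf, hg⟩))

theorem Plane.eq_toLp (p : Plane) : p = !₂[p 0, p 1] := by
  ext i
  fin_cases i <;> rfl

theorem connectedComponentIn_eq_of_subset_interior {X : Type*} [TopologicalSpace X]
    {N R Z : Set X} {p : X} (hN : IsPreconnected N) (hNR : N ⊆ R) (hNZ : N ⊆ interior Z)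
    (hZ : IsClosed Z) (hRZ : R ∩ Z ⊆ N) (hp : p ∈ N) : connectedComponentIn R p = N := by
  refine Subset.antisymm ?_ (hN.subset_connectedComponentIn hp hNR)
  have hsub := connectedComponentIn_subset R p
  have hint : connectedComponentIn R p ⊆ interior Z :=
    isPreconnected_connectedComponentIn.subset_left_of_subset_union isOpen_interior
      hZ.isOpen_compl (disjoint_compl_right_iff_subset.2 interior_subset)
      (fun q hq => (em (q ∈ Z)).imp (fun hqZ => hNZ (hRZ ⟨hsub hq, hqZ⟩)) id)
      ⟨p, mem_connectedComponentIn (hNR hp), hNZ hp⟩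
  exact fun q hq => hRZ ⟨hsub hq, interior_subset (hint hq)⟩

/-- The closed region between the graphs of `f` and `g` over `I`. For `f = g` it is a graph, and for
a singleton `I` it is a vertical segment. -/
def band (I : Set ℝ) (f g : ℝ → ℝ) : Set Plane :=
  {p | p 0 ∈ I ∧ p 1 ∈ Icc (f (p 0)) (g (p 0))}

variable {I : Set ℝ} {f g : ℝ → ℝ} {a b u : ℝ}

theorem band_inter (I J : Set ℝ) (f g : ℝ → ℝ) : band I f g ∩ band J f g = band (I ∩ J) f g := by
  ext p
  exact and_and_right.symm

theorem band_eq_image (h : ∀ u ∈ I, f u ≤ g u) :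
    band I f g =
      (fun q : ℝ × ℝ => !₂[q.1, AffineMap.lineMap (f q.1) (g q.1) q.2]) '' I ×ˢ Icc 0 1 := by
  ext p
  constructor
  · rintro ⟨h0, h1⟩
    rw [← segment_eq_Icc (h _ h0), segment_eq_image_lineMap] at h1
    obtain ⟨σ, hσ, h1⟩ := h1
    exact ⟨(p 0, σ), ⟨h0, hσ⟩, (congrArg (!₂[p 0, ·]) h1).trans p.eq_toLp.symm⟩
  · rintro ⟨⟨u, σ⟩, ⟨hu, hσ⟩, rfl⟩
    refine ⟨hu, ?_⟩
    change AffineMap.lineMap (f u) (g u) σ ∈ Icc (f u) (g u)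
    rw [← segment_eq_Icc (h u hu), segment_eq_image_lineMap]
    exact mem_image_of_mem _ hσ

theorem continuous_lineMap_graph (hf : Continuous f) (hg : Continuous g) :
    Continuous fun q : ℝ × ℝ => (!₂[q.1, AffineMap.lineMap (f q.1) (g q.1) q.2] : Plane) :=
  continuous_toPlane continuous_fst (by simp only [AffineMap.lineMap_apply_module]; fun_prop)

theorem isPreconnected_band (hI : IsPreconnected I) (hf : Continuous f) (hg : Continuous g)
    (h : ∀ u ∈ I, f u ≤ g u) : IsPreconnected (band I f g) := by
  rw [band_eq_image h]
  exact (hI.prod isPreconnected_Icc).image _ (continuous_lineMap_graph hf hg).continuousOn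

theorem band_subset_closure (hab : a ≠ b) (hf : Continuous f) (hg : Continuous g)
    (h : ∀ u ∈ Icc a b, f u < g u) :
    band (Icc a b) f g ⊆ closure {p | p 0 ∈ Ioo a b ∧ p 1 ∈ Ioo (f (p 0)) (g (p 0))} := by
  rw [band_eq_image fun u hu => (h u hu).le, ← closure_Ioo hab, ← closure_Ioo zero_ne_one,
    ← closure_prod_eq]
  refine (image_closure_subset_closure_image (continuous_lineMap_graph hf hg)).trans
    (closure_mono ?_)
  rintro _ ⟨⟨u, σ⟩, ⟨hu, hσ⟩, rfl⟩
  refine ⟨hu, ?_⟩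
  change AffineMap.lineMap (f u) (g u) σ ∈ Ioo (f u) (g u)
  rw [← openSegment_eq_Ioo (h u (Ioo_subset_Icc_self hu)), openSegment_eq_image_lineMap]
  exact mem_image_of_mem _ hσ

theorem band_singleton_eq_segment (h : f u ≤ g u) :
    band {u} f g = segment ℝ !₂[u, f u] !₂[u, g u] := by
  rw [band_eq_image (by simpa using h), singleton_prod, image_image, segment_eq_image_lineMap]
  refine image_congr fun σ _ => ?_
  ext i
  fin_cases i <;> simp [AffineMap.lineMap_apply]

end Planar

section Arcs

variable {z : Plane} {r a b : ℝ}

theorem circlePoint_arccos (hr : 0 < r) {c : ℝ} (hc : |c| ≤ r) :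
    circlePoint z r (Real.arccos (c / r)) = !₂[z 0 + c, z 1 + √(r ^ 2 - c ^ 2)] := by
  have hc' : |c / r| ≤ 1 := by rwa [abs_div, abs_of_pos hr, div_le_one hr]
  have hcos : r * Real.cos (Real.arccos (c / r)) = c := by
    rw [Real.cos_arccos (abs_le.1 hc').1 (abs_le.1 hc').2, mul_div_cancel₀ _ hr.ne']
  have hsin : r * Real.sin (Real.arccos (c / r)) = √(r ^ 2 - c ^ 2) := by
    rw [Real.sin_arccos, ← Real.sqrt_sq hr.le, ← Real.sqrt_mul (sq_nonneg r), Real.sqrt_sq hr.le]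
    congr 1
    field_simp
  rw [circlePoint, hcos, hsin]

theorem strictAntiOn_arccos_div (hr : 0 < r) :
    StrictAntiOn (fun c => Real.arccos (c / r)) (Icc (-r) r) := by
  have hmem : ∀ c ∈ Icc (-r) r, c / r ∈ Icc (-1) 1 := fun c hc =>
    ⟨by rw [le_div_iff₀ hr]; linarith [hc.1], by rw [div_le_one hr]; exact hc.2⟩
  exact fun c hc d hd hcd =>
    Real.strictAntiOn_arccos (hmem c hc) (hmem d hd) (by gcongr)

/-- The ordinates of the upper half of the circle of radius `r` around `(0, y)`, as a function of
the abscissa. -/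
noncomputable def upperArc (y r u : ℝ) : ℝ := y + √(r ^ 2 - u ^ 2)

/-- The ordinates of the lower half of the circle of radius `r` around `(0, y)`, as a function of
the abscissa. -/
noncomputable def lowerArc (y r u : ℝ) : ℝ := y - √(r ^ 2 - u ^ 2)

theorem continuous_upperArc (y r : ℝ) : Continuous (upperArc y r) := by
  unfold upperArc
  fun_prop

theorem continuous_lowerArc (y r : ℝ) : Continuous (lowerArc y r) := by
  unfold lowerArc
  fun_prop

theorem upperArc_lt_iff {p : Plane} {y : ℝ} (hr : 0 ≤ r) (hy : y < p 1) :
    upperArc y r (p 0) < p 1 ↔ r < dist p !₂[0, y] := by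
  rw [upperArc, ← lt_sub_iff_add_lt', Real.sqrt_lt' (sub_pos.2 hy), Plane.lt_dist_iff hr,
    sub_lt_iff_lt_add']
  simp

theorem lt_lowerArc_iff {p : Plane} {y : ℝ} (hr : 0 ≤ r) (hy : p 1 < y) :
    p 1 < lowerArc y r (p 0) ↔ r < dist p !₂[0, y] := by
  rw [lowerArc, lt_sub_comm, Real.sqrt_lt' (sub_pos.2 hy), Plane.lt_dist_iff hr,
    sub_lt_iff_lt_add', sub_sq_comm]
  simp

theorem upperArc_le_iff {p : Plane} {y : ℝ} (hr : 0 ≤ r) (hy : y ≤ p 1) :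
    upperArc y r (p 0) ≤ p 1 ↔ r ≤ dist p !₂[0, y] := by
  rw [upperArc, ← le_sub_iff_add_le', Real.sqrt_le_left (sub_nonneg.2 hy), Plane.le_dist_iff hr,
    sub_le_iff_le_add']
  simp

theorem le_lowerArc_iff {p : Plane} {y : ℝ} (hr : 0 ≤ r) (hy : p 1 ≤ y) :
    p 1 ≤ lowerArc y r (p 0) ↔ r ≤ dist p !₂[0, y] := by
  rw [lowerArc, le_sub_comm, Real.sqrt_le_left (sub_nonneg.2 hy), Plane.le_dist_iff hr,
    sub_le_iff_le_add', sub_sq_comm]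
  simp

theorem isArcWithInterior_band_upperArc (ha : -r ≤ a) (hab : a < b) (hb : b ≤ r) (y : ℝ) :
    IsArcWithInterior (band (Icc a b) (upperArc y r) (upperArc y r))
      (band (Ioo a b) (upperArc y r) (upperArc y r)) := by
  have hr : 0 < r := by linarith
  have hanti : StrictAntiOn (fun c => Real.arccos (c / r)) (Icc a b) :=
    (strictAntiOn_arccos_div hr).mono (Icc_subset_Icc ha hb)
  have hcont : ContinuousOn (fun c => Real.arccos (c / r)) (Icc a b) := by fun_prop
  have hgraph : ∀ J ⊆ Icc a b, band J (upperArc y r) (upperArc y r) =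
      circlePoint !₂[0, y] r '' ((fun c => Real.arccos (c / r)) '' J) := fun J hJ => by
    have hmem : ∀ u ∈ J, |u| ≤ r := fun u hu =>
      abs_le.2 ⟨ha.trans (hJ hu).1, (hJ hu).2.trans hb⟩
    rw [image_image, image_congr fun u hu => circlePoint_arccos hr (hmem u hu)]
    ext p
    simp only [band, Icc_self, mem_singleton_iff, mem_ofPred_eq, mem_image]
    constructor
    · rintro ⟨h0, h1⟩
      exact ⟨p 0, h0, by rw [p.eq_toLp, h1]; simp [upperArc]⟩
    · rintro ⟨u, hu, rfl⟩
      simpa [upperArc] using hu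
  refine ⟨!₂[0, y], r, Real.arccos (b / r), Real.arccos (a / r), hr,
    hanti (left_mem_Icc.2 hab.le) (right_mem_Icc.2 hab.le) hab, ?_, ?_, ?_⟩
  · linarith [Real.arccos_nonneg (b / r), Real.arccos_le_pi (a / r), Real.pi_pos]
  · rw [hgraph _ Subset.rfl, hcont.image_Icc_of_antitoneOn hab.le hanti.antitoneOn]
  · rw [hgraph _ Ioo_subset_Icc_self, hcont.image_Ioo_of_strictAntiOn hab.le hanti]

theorem IsArcWithInterior.subset {E I : Set Plane} (h : IsArcWithInterior E I) : I ⊆ E := by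
  obtain ⟨z, r, α, β, -, -, -, rfl, rfl⟩ := h
  exact image_mono Ioo_subset_Icc_self

end Arcs

section Notches

/-- The closed rectangle with center abscissa `x`, half width `ε`, and ordinates from `y` to
`y + t`. -/
def notchBox (x ε y t : ℝ) : Set Plane :=
  {p | p 0 ∈ Icc (x - ε) (x + ε) ∧ p 1 ∈ Icc y (y + t)}

/-- The part of the vertical strip of width `ε` around the abscissa `x` between the discs of
radius `r` around `(0, y)` and `(0, y + t)`. -/
def notchRegion (x ε y t r : ℝ) : Set Plane :=
  band (Icc (x - ε / 2) (x + ε / 2)) (upperArc y r) (lowerArc (y + t) r)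

/-- The circular arc at the bottom of `notchRegion`. -/
def notchArc (x ε y r : ℝ) : Set Plane :=
  band (Icc (x - ε / 2) (x + ε / 2)) (upperArc y r) (upperArc y r)

/-- The vertical segment at the right end of `notchRegion`. -/
def notchSide (x ε y t r : ℝ) : Set Plane :=
  band {x + ε / 2} (upperArc y r) (lowerArc (y + t) r)

/-- The common endpoint of `notchArc` and `notchSide`. -/
noncomputable def notchCorner (x ε y r : ℝ) : Plane :=
  !₂[x + ε / 2, upperArc y r (x + ε / 2)]

/-- The discs of radius `r` around `(0, y)` and `(0, y + t)` meet all vertical lines with abscissas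
from `x - ε` to `x + ε`, but not each other there. -/
structure IsNotchShape (x ε t r : ℝ) : Prop where
  ε_pos : 0 < ε
  t_pos : 0 < t
  pos : 0 < x - ε
  lt : x + ε < r
  gap : r ^ 2 < (x - ε) ^ 2 + (t / 2) ^ 2

theorem isClosed_notchBox (x ε y t : ℝ) : IsClosed (notchBox x ε y t) :=
  (isClosed_Icc.preimage (by fun_prop)).inter (isClosed_Icc.preimage (by fun_prop))

theorem isPreconnected_notchArc (x ε y r : ℝ) : IsPreconnected (notchArc x ε y r) :=
  isPreconnected_band isPreconnected_Icc (continuous_upperArc y r) (continuous_upperArc y r)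
    fun _ _ => le_rfl

namespace IsNotchShape

variable {x ε y t r u : ℝ} {p : Plane}

theorem r_pos (h : IsNotchShape x ε t r) : 0 < r := by linarith [h.ε_pos, h.pos, h.lt]

theorem lt_upperArc (h : IsNotchShape x ε t r) (hu : u ∈ Icc (x - ε) (x + ε)) :
    y < upperArc y r u :=
  lt_add_of_pos_right y (Real.sqrt_pos.2 (by nlinarith [h.pos, h.lt, hu.1, hu.2]))

theorem lowerArc_lt (h : IsNotchShape x ε t r) (hu : u ∈ Icc (x - ε) (x + ε)) :
    lowerArc y r u < y :=
  sub_lt_self y (Real.sqrt_pos.2 (by nlinarith [h.pos, h.lt, hu.1, hu.2]))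

theorem sqrt_lt (h : IsNotchShape x ε t r) (hu : u ∈ Icc (x - ε) (x + ε)) :
    √(r ^ 2 - u ^ 2) < t / 2 := by
  rw [Real.sqrt_lt' (half_pos h.t_pos)]
  nlinarith [h.gap, h.pos, hu.1]

theorem upperArc_lt_add_half (h : IsNotchShape x ε t r) (hu : u ∈ Icc (x - ε) (x + ε)) :
    upperArc y r u < y + t / 2 :=
  add_lt_add_right (h.sqrt_lt hu) y

theorem upperArc_lt_lowerArc (h : IsNotchShape x ε t r) (hu : u ∈ Icc (x - ε) (x + ε)) :
    upperArc y r u < lowerArc (y + t) r u := by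
  unfold upperArc lowerArc
  linarith [h.sqrt_lt hu]

theorem Icc_half_subset (h : IsNotchShape x ε t r) :
    Icc (x - ε / 2) (x + ε / 2) ⊆ Icc (x - ε) (x + ε) :=
  Icc_subset_Icc (by linarith [h.ε_pos]) (by linarith [h.ε_pos])

theorem add_half_mem (h : IsNotchShape x ε t r) : x + ε / 2 ∈ Icc (x - ε / 2) (x + ε / 2) :=
  right_mem_Icc.2 (by linarith [h.ε_pos])

theorem notchRegion_subset_interior_notchBox (h : IsNotchShape x ε t r) :
    notchRegion x ε y t r ⊆ interior (notchBox x ε y t) := by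
  have hopen : IsOpen {p : Plane | p 0 ∈ Ioo (x - ε) (x + ε) ∧ p 1 ∈ Ioo y (y + t)} :=
    (isOpen_Ioo.preimage (by fun_prop)).inter (isOpen_Ioo.preimage (by fun_prop))
  refine Subset.trans (fun p hp => ?_) (interior_maximal (fun p hp =>
    ⟨Ioo_subset_Icc_self hp.1, Ioo_subset_Icc_self hp.2⟩) hopen)
  have hu := h.Icc_half_subset hp.1
  exact ⟨⟨by linarith [hp.1.1, h.ε_pos], by linarith [hp.1.2, h.ε_pos]⟩,
    (h.lt_upperArc hu).trans_le hp.2.1, hp.2.2.trans_lt (h.lowerArc_lt hu)⟩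

theorem notchRegion_subset_notchBox (h : IsNotchShape x ε t r) :
    notchRegion x ε y t r ⊆ notchBox x ε y t :=
  h.notchRegion_subset_interior_notchBox.trans interior_subset

theorem isPreconnected_notchRegion (h : IsNotchShape x ε t r) :
    IsPreconnected (notchRegion x ε y t r) :=
  isPreconnected_band isPreconnected_Icc (continuous_upperArc y r) (continuous_lowerArc _ r)
    fun _ hu => (h.upperArc_lt_lowerArc (h.Icc_half_subset hu)).le

theorem notchArc_subset_notchRegion (h : IsNotchShape x ε t r) :
    notchArc x ε y r ⊆ notchRegion x ε y t r := fun _ hp =>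
  ⟨hp.1, hp.2.1, hp.2.2.trans
    (h.upperArc_lt_lowerArc (h.Icc_half_subset hp.1)).le⟩

theorem notchCorner_mem_notchArc (h : IsNotchShape x ε t r) :
    notchCorner x ε y r ∈ notchArc x ε y r :=
  ⟨h.add_half_mem, le_rfl, le_rfl⟩

theorem notchCorner_mem_notchSide (h : IsNotchShape x ε t r) :
    notchCorner x ε y r ∈ notchSide x ε y t r :=
  ⟨rfl, le_rfl, (h.upperArc_lt_lowerArc (h.Icc_half_subset h.add_half_mem)).le⟩

theorem notchCorner_mem_notchRegion (h : IsNotchShape x ε t r) :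
    notchCorner x ε y r ∈ notchRegion x ε y t r :=
  h.notchArc_subset_notchRegion h.notchCorner_mem_notchArc

theorem notchRegion_inter_notchRegion (h : IsNotchShape x ε t r) :
    notchRegion x ε y t r ∩ notchRegion (x + ε) ε y t r = notchSide x ε y t r := by
  have hε := h.ε_pos
  rw [notchRegion, notchRegion, band_inter, show x + ε - ε / 2 = x + ε / 2 by ring,
    Icc_inter_Icc_eq_singleton (by linarith) (by linarith), notchSide]

theorem isSegment_notchSide (h : IsNotchShape x ε t r) : IsSegment (notchSide x ε y t r) := by
  have hlt := h.upperArc_lt_lowerArc (y := y) (h.Icc_half_subset h.add_half_mem)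
  refine ⟨_, _, fun heq => hlt.ne ?_, band_singleton_eq_segment hlt.le⟩
  simpa using congrArg (fun p : Plane => p 1) heq

theorem isArcWithInterior_notchArc (h : IsNotchShape x ε t r) :
    IsArcWithInterior (notchArc x ε y r)
      (band (Ioo (x - ε / 2) (x + ε / 2)) (upperArc y r) (upperArc y r)) :=
  isArcWithInterior_band_upperArc (by linarith [h.ε_pos, h.pos, h.lt]) (by linarith [h.ε_pos])
    (by linarith [h.ε_pos, h.lt]) y

theorem left_mem_notchArc (h : IsNotchShape x ε t r) :
    !₂[x - ε / 2, upperArc y r (x - ε / 2)] ∈ notchArc x ε y r :=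
  ⟨left_mem_Icc.2 (by linarith [h.ε_pos]), le_rfl, le_rfl⟩

theorem notchRegion_ne_notchRegion (h : IsNotchShape x ε t r) :
    notchRegion x ε y t r ≠ notchRegion (x + ε) ε y t r := fun heq => by
  have hle : x + ε - ε / 2 ≤ x - ε / 2 :=
    (heq.subset (h.notchArc_subset_notchRegion h.left_mem_notchArc)).1.1
  linarith [h.ε_pos]

theorem notchRegion_ne_notchArc (h : IsNotchShape x ε t r) :
    notchRegion x ε y t r ≠ notchArc x ε y r := fun heq => by
  have hlt := h.upperArc_lt_lowerArc (y := y) (h.Icc_half_subset h.add_half_mem)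
  have hmem : (!₂[x + ε / 2, lowerArc (y + t) r (x + ε / 2)] : Plane) ∈ notchRegion x ε y t r :=
    ⟨h.add_half_mem, hlt.le, le_rfl⟩
  exact hlt.not_ge (heq.subset hmem).2.2

theorem notchArc_ne_notchSide (h : IsNotchShape x ε t r) :
    notchArc x ε y r ≠ notchSide x ε y t r := fun heq => by
  have heq : x - ε / 2 = x + ε / 2 := (heq.subset h.left_mem_notchArc).1
  linarith [h.ε_pos]

end IsNotchShape

end Notches

section NotchesOfDiagrams

variable {ι : Type*} {s : ι → Plane} {ρ : ι → ℝ} {A P Q : ι} {x ε y t r Y : ℝ} {p : Plane}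

/-- Near the strip around the abscissa `x`, in which `s A` lies at the height `Y`, the discs of
`s P = (0, y)` and `s Q = (0, y + t)` are the only ones apart from those of the sites at the height
`Y`. They leave a gap there, which is within the reach of `s A` and of its two neighbors at the
height `Y`. -/
structure IsNotch (s : ι → Plane) (ρ : ι → ℝ) (A P Q : ι) (x ε y t r Y : ℝ) : Prop
    extends IsNotchShape x ε t r where
  site_A : s A = !₂[x, Y]
  site_P : s P = !₂[0, y]
  site_Q : s Q = !₂[0, y + t]
  radius_P : ρ P = r
  radius_Q : ρ Q = r
  reach : ∀ p ∈ notchBox x ε y t, dist p (s A) < ρ A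
  left : ∃ B, s B = !₂[x - ε, Y] ∧ ∀ p ∈ notchBox x ε y t, dist p (s B) < ρ B
  right : ∃ B, s B = !₂[x + ε, Y] ∧ ∀ p ∈ notchBox x ε y t, dist p (s B) < ρ B
  others : ∀ k, k ≠ A → k ≠ P → k ≠ Q →
    (∀ p ∈ notchBox x ε y t, ρ k < dist p (s k)) ∨ s k 1 = Y ∧ ε ≤ |s k 0 - x|
  prefer_P : ∀ p, dist p (s P) < r → dist p (s P) < dist p (s A)
  prefer_Q : ∀ p, dist p (s Q) < r → dist p (s Q) < dist p (s A)
  strip : ∀ p, dist p (s P) < r → |p 1 - y| < t / 2 → p ∈ openCell s ρ P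

namespace IsNotch

theorem mem_notchRegion (h : IsNotch s ρ A P Q x ε y t r Y) (hbox : p ∈ notchBox x ε y t)
    (hA : p ∈ radiiDiagram s ρ (some A)) : p ∈ notchRegion x ε y t r := by
  obtain ⟨B, hB, hreach⟩ := h.left
  obtain ⟨B', hB', hreach'⟩ := h.right
  have hleft := (Plane.dist_le_dist_iff_abs_sub_le 0 (by simp [h.site_A, hB])).1
    (dist_le_dist_of_mem_radiiDiagram hA (hreach p hbox))
  have hright := (Plane.dist_le_dist_iff_abs_sub_le 0 (by simp [h.site_A, hB'])).1
    (dist_le_dist_of_mem_radiiDiagram hA (hreach' p hbox))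
  simp only [h.site_A, hB, hB', Matrix.cons_val_zero, ← sq_le_sq] at hleft hright
  have hε := h.ε_pos
  refine ⟨⟨by nlinarith, by nlinarith⟩, ?_, ?_⟩
  · rw [upperArc_le_iff h.r_pos.le hbox.2.1, ← h.site_P, ← not_lt]
    exact fun hlt => (dist_le_dist_of_mem_radiiDiagram hA (hlt.trans_eq h.radius_P.symm)).not_gt
      (h.prefer_P p hlt)
  · rw [le_lowerArc_iff h.r_pos.le hbox.2.2, ← h.site_Q, ← not_lt]
    exact fun hlt => (dist_le_dist_of_mem_radiiDiagram hA (hlt.trans_eq h.radius_Q.symm)).not_gt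
      (h.prefer_Q p hlt)

theorem dist_lt_of_abs_lt (h : IsNotch s ρ A P Q x ε y t r Y) {k : ι} (hp : |p 0 - x| < ε / 2)
    (hk : s k 1 = Y) (hkx : ε ≤ |s k 0 - x|) : dist p (s A) < dist p (s k) := by
  have hA0 : s A 0 = x := by simp [h.site_A]
  rw [Plane.dist_lt_dist_iff_abs_sub_lt 0 (by simp [h.site_A, hk]), hA0]
  have := abs_sub_le (s k 0) (p 0) x
  rw [abs_sub_comm (s k 0) (p 0)] at this
  linarith

theorem mem_openCell (h : IsNotch s ρ A P Q x ε y t r Y)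
    (hp : p 0 ∈ Ioo (x - ε / 2) (x + ε / 2))
    (hp' : p 1 ∈ Ioo (upperArc y r (p 0)) (lowerArc (y + t) r (p 0))) : p ∈ openCell s ρ A := by
  have hbox : p ∈ notchBox x ε y t :=
    h.notchRegion_subset_notchBox ⟨Ioo_subset_Icc_self hp, Ioo_subset_Icc_self hp'⟩
  have hu := h.Icc_half_subset (Ioo_subset_Icc_self hp)
  refine ⟨h.reach p hbox, fun k hkA => ?_⟩
  rcases eq_or_ne k P with rfl | hkP
  · left
    rw [h.radius_P, h.site_P]
    exact (upperArc_lt_iff h.r_pos.le ((h.lt_upperArc hu).trans hp'.1)).1 hp'.1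
  rcases eq_or_ne k Q with rfl | hkQ
  · left
    rw [h.radius_Q, h.site_Q]
    exact (lt_lowerArc_iff h.r_pos.le (hp'.2.trans (h.lowerArc_lt hu))).1 hp'.2
  refine (h.others k hkA hkP hkQ).imp (fun hfar => hfar p hbox) fun ⟨hkY, hkx⟩ => ?_
  exact h.dist_lt_of_abs_lt (abs_sub_lt_iff.2 ⟨by linarith [hp.2], by linarith [hp.1]⟩) hkY hkx

theorem notchRegion_subset_radiiDiagram (h : IsNotch s ρ A P Q x ε y t r Y) :
    notchRegion x ε y t r ⊆ radiiDiagram s ρ (some A) :=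
  (band_subset_closure (by linarith [h.ε_pos]) (continuous_upperArc y r) (continuous_lowerArc _ r)
    fun _ hu => h.upperArc_lt_lowerArc (h.Icc_half_subset hu)).trans
    (closure_mono fun _ hp => h.mem_openCell hp.1 hp.2)

theorem connectedComponentIn_eq_notchRegion (h : IsNotch s ρ A P Q x ε y t r Y)
    (hp : p ∈ notchRegion x ε y t r) :
    connectedComponentIn (radiiDiagram s ρ (some A)) p = notchRegion x ε y t r :=
  connectedComponentIn_eq_of_subset_interior h.isPreconnected_notchRegion
    h.notchRegion_subset_radiiDiagram h.notchRegion_subset_interior_notchBox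
    (isClosed_notchBox x ε y t) (fun _ hq => h.mem_notchRegion hq.2 hq.1) hp

theorem notchRegion_mem_componentsOf (h : IsNotch s ρ A P Q x ε y t r Y) :
    notchRegion x ε y t r ∈ componentsOf (radiiDiagram s ρ (some A)) :=
  ⟨_, h.notchRegion_subset_radiiDiagram h.notchCorner_mem_notchRegion,
    (h.connectedComponentIn_eq_notchRegion h.notchCorner_mem_notchRegion).symm⟩

theorem notchRegion_mem_faces (h : IsNotch s ρ A P Q x ε y t r Y) :
    notchRegion x ε y t r ∈ faces (radiiDiagram s ρ) :=
  ⟨_, h.notchRegion_mem_componentsOf⟩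

theorem notchSide_mem_straightEdges {A' : ι} (h : IsNotch s ρ A P Q x ε y t r Y)
    (h' : IsNotch s ρ A' P Q (x + ε) ε y t r Y) :
    notchSide x ε y t r ∈ straightEdges (radiiDiagram s ρ) :=
  ⟨_, h.notchRegion_mem_faces, _, h'.notchRegion_mem_faces, h.notchRegion_ne_notchRegion,
    ⟨h.isSegment_notchSide, h.notchRegion_inter_notchRegion.ge⟩,
    fun _ hE _ => hE.2.trans_eq h.notchRegion_inter_notchRegion⟩

theorem notchArc_subset_radiiDiagram (h : IsNotch s ρ A P Q x ε y t r Y) :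
    notchArc x ε y r ⊆ radiiDiagram s ρ (some P) := by
  have hsub := band_subset_closure (a := x - ε / 2) (b := x + ε / 2) (f := fun _ => y)
    (by linarith [h.ε_pos]) continuous_const (continuous_upperArc y r)
    fun _ hu => h.lt_upperArc (h.Icc_half_subset hu)
  refine Subset.trans (fun p hp => ?_) (hsub.trans (closure_mono fun p hp => ?_))
  · exact ⟨hp.1, (h.lt_upperArc (h.Icc_half_subset hp.1)).le.trans hp.2.1, hp.2.2⟩
  · have hhalf := h.upperArc_lt_add_half (y := y) (h.Icc_half_subset (Ioo_subset_Icc_self hp.1))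
    refine h.strip p ?_ (abs_sub_lt_iff.2 ⟨by linarith [hp.2.2], by linarith [hp.2.1, h.t_pos]⟩)
    rw [h.site_P, ← not_le, ← upperArc_le_iff h.r_pos.le hp.2.1.le, not_le]
    exact hp.2.2

theorem notchRegion_inter_component (h : IsNotch s ρ A P Q x ε y t r Y)
    (hp : p ∈ notchArc x ε y r) :
    notchRegion x ε y t r ∩ connectedComponentIn (radiiDiagram s ρ (some P)) p =
      notchArc x ε y r := by
  refine Subset.antisymm (fun q hq => ?_) (subset_inter h.notchArc_subset_notchRegion
    ((isPreconnected_notchArc x ε y r).subset_connectedComponentIn hp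
      h.notchArc_subset_radiiDiagram))
  refine ⟨hq.1.1, hq.1.2.1, ?_⟩
  have hdist := dist_le_of_mem_radiiDiagram (connectedComponentIn_subset _ _ hq.2)
  have hy : y < q 1 := (h.lt_upperArc (h.Icc_half_subset hq.1.1)).trans_le hq.1.2.1
  rwa [h.radius_P, h.site_P, ← not_lt, ← upperArc_lt_iff h.r_pos.le hy, not_lt] at hdist

theorem eq_some_of_mem_radiiDiagram (h : IsNotch s ρ A P Q x ε y t r Y)
    (hp : p ∈ band (Ioo (x - ε / 2) (x + ε / 2)) (upperArc y r) (upperArc y r)) {o : Option ι}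
    (ho : p ∈ radiiDiagram s ρ o) : o = some A ∨ o = some P := by
  have hp0 := Ioo_subset_Icc_self hp.1
  have hbox := h.notchRegion_subset_notchBox (y := y) (h.notchArc_subset_notchRegion ⟨hp0, hp.2⟩)
  have hreach := h.reach p hbox
  cases o with
  | none => exact absurd hreach (le_dist_of_mem_radiiDiagram_none A ho).not_gt
  | some k =>
    by_contra! hk
    have hdist := dist_le_of_mem_radiiDiagram ho
    rcases eq_or_ne k Q with rfl | hkQ
    · have hlt := hp.2.2.trans_lt (h.upperArc_lt_lowerArc (h.Icc_half_subset hp0))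
      rw [lt_lowerArc_iff h.r_pos.le (hlt.trans (h.lowerArc_lt (h.Icc_half_subset hp0))),
        ← h.site_Q, ← h.radius_Q] at hlt
      exact hdist.not_gt hlt
    · rcases h.others k (hk.1 <| congrArg some ·) (hk.2 <| congrArg some ·) hkQ with
        hfar | ⟨hkY, hkx⟩
      · exact hdist.not_gt (hfar p hbox)
      · exact (dist_le_dist_of_mem_radiiDiagram ho hreach).not_gt (h.dist_lt_of_abs_lt
          (abs_sub_lt_iff.2 ⟨by linarith [hp.1.2], by linarith [hp.1.1]⟩) hkY hkx)

theorem component_eq_of_mem (h : IsNotch s ρ A P Q x ε y t r Y)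
    (hp : p ∈ band (Ioo (x - ε / 2) (x + ε / 2)) (upperArc y r) (upperArc y r)) {F : Set Plane}
    (hF : F ∈ faces (radiiDiagram s ρ)) (hpF : p ∈ F) :
    F = notchRegion x ε y t r ∨ F = connectedComponentIn (radiiDiagram s ρ (some P)) p := by
  obtain ⟨o, z, -, rfl⟩ := hF
  rw [connectedComponentIn_eq hpF]
  rcases h.eq_some_of_mem_radiiDiagram hp (connectedComponentIn_subset _ _ hpF) with rfl | rfl
  · exact Or.inl (h.connectedComponentIn_eq_notchRegion
      (h.notchArc_subset_notchRegion ⟨Ioo_subset_Icc_self hp.1, hp.2⟩))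
  · exact Or.inr rfl

theorem eq_notchArc_of_mem_maximalArcs (h : IsNotch s ρ A P Q x ε y t r Y)
    (hp : p ∈ band (Ioo (x - ε / 2) (x + ε / 2)) (upperArc y r) (upperArc y r)) {E : Set Plane}
    (hE : E ∈ maximalArcs (radiiDiagram s ρ)) (hpE : p ∈ E) : E = notchArc x ε y r := by
  obtain ⟨F, hF, F', hF', hne, ⟨-, hEF⟩, hmax⟩ := hE
  have hinter : F ∩ F' = notchArc x ε y r := by
    have hP := h.notchRegion_inter_component (h.isArcWithInterior_notchArc.subset hp)
    rcases h.component_eq_of_mem hp hF (hEF hpE).1 with hF | hF <;>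
      rcases h.component_eq_of_mem hp hF' (hEF hpE).2 with hF' | hF'
    · exact absurd (hF.trans hF'.symm) hne
    · rw [hF, hF', hP]
    · rw [hF, hF', inter_comm, hP]
    · exact absurd (hF.trans hF'.symm) hne
  rw [hinter] at hEF hmax
  exact hEF.antisymm (hmax ⟨⟨_, h.isArcWithInterior_notchArc⟩, Subset.rfl⟩ hEF)

theorem disjoint_tangencyPoints (h : IsNotch s ρ A P Q x ε y t r Y) :
    Disjoint (band (Ioo (x - ε / 2) (x + ε / 2)) (upperArc y r) (upperArc y r))
      (tangencyPoints (radiiDiagram s ρ)) := by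
  refine Set.disjoint_left.2 ?_
  rintro p hp ⟨E₁, hE₁, E₂, hE₂, hne, ⟨_, hI₁, hp₁⟩, ⟨_, hI₂, hp₂⟩⟩
  exact hne ((h.eq_notchArc_of_mem_maximalArcs hp hE₁ (hI₁.subset hp₁)).trans
    (h.eq_notchArc_of_mem_maximalArcs hp hE₂ (hI₂.subset hp₂)).symm)

theorem notchArc_mem_curvedEdges (h : IsNotch s ρ A P Q x ε y t r Y) :
    notchArc x ε y r ∈ curvedEdges (radiiDiagram s ρ) := by
  have hmem := h.notchCorner_mem_notchArc (y := y)
  have hinter := h.notchRegion_inter_component hmem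
  refine ⟨_, h.notchRegion_mem_faces, _, ⟨some P, _, h.notchArc_subset_radiiDiagram hmem, rfl⟩,
    fun heq => ?_, ⟨⟨_, h.isArcWithInterior_notchArc, h.disjoint_tangencyPoints⟩, hinter.ge⟩,
    fun _ hE _ => hE.2.trans_eq hinter⟩
  rw [← heq, inter_self] at hinter
  exact h.notchRegion_ne_notchArc hinter

theorem notchCorner_mem_vertices {A' : ι} (h : IsNotch s ρ A P Q x ε y t r Y)
    (h' : IsNotch s ρ A' P Q (x + ε) ε y t r Y) :
    notchCorner x ε y r ∈ vertices (radiiDiagram s ρ) :=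
  ⟨_, Or.inr h.notchArc_mem_curvedEdges, _, Or.inl (h.notchSide_mem_straightEdges h'),
    h.notchArc_ne_notchSide, h.notchCorner_mem_notchArc, h.notchCorner_mem_notchSide⟩

end IsNotch

end NotchesOfDiagrams

section Grids

variable {ι : Type*} {s : ι → Plane} {ρ : ι → ℝ} {A P : ℕ → ι} {I J : ℕ} {x ε y t r Y : ℝ}

/-- Every one of the strips of the sites `A 0, …, A I`, which have width `ε`, has a notch between
any two consecutive ones of the discs of radius `r` around `P 0, …, P J`, whose centers have
distance `t`. -/
def IsNotchGrid (s : ι → Plane) (ρ : ι → ℝ) (A P : ℕ → ι) (I J : ℕ) (x ε y t r Y : ℝ) :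
    Prop :=
  ∀ i ≤ I, ∀ j < J, IsNotch s ρ (A i) (P j) (P (j + 1)) (x + i * ε) ε (y + j * t) t r Y

namespace IsNotchGrid

theorem isNotch_succ (h : IsNotchGrid s ρ A P I J x ε y t r Y) {i j : ℕ} (hi : i < I)
    (hj : j < J) :
    IsNotch s ρ (A (i + 1)) (P j) (P (j + 1)) (x + i * ε + ε) ε (y + j * t) t r Y := by
  have hsucc := h (i + 1) hi j hj
  rwa [Nat.cast_add_one, add_one_mul, ← add_assoc] at hsucc

theorem le_of_notchCorner_mem_notchRegion (h : IsNotchGrid s ρ A P I J x ε y t r Y)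
    {i i' j j' : ℕ} (hi : i ≤ I) (hi' : i' ≤ I) (hj : j < J) (hj' : j' < J)
    (hmem : notchCorner (x + i * ε) ε (y + j * t) r ∈
      notchRegion (x + i' * ε) ε (y + j' * t) t r) : i ≤ i' ∧ j ≤ j' := by
  have hN := h i hi j hj
  have hx : x + i * ε + ε / 2 ≤ x + i' * ε + ε / 2 := hmem.1.2
  have hlow : y + j * t < upperArc (y + j * t) r (x + i * ε + ε / 2) :=
    hN.lt_upperArc (hN.Icc_half_subset hN.add_half_mem)
  have hupp : upperArc (y + j * t) r (x + i * ε + ε / 2) ≤ y + j' * t + t :=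
    ((h i' hi' j' hj').notchRegion_subset_notchBox hmem).2.2
  constructor
  · exact_mod_cast le_of_mul_le_mul_right (show (i : ℝ) * ε ≤ i' * ε by linarith) hN.ε_pos
  · have hlt := lt_of_mul_lt_mul_right (show (j : ℝ) * t < (j' + 1) * t by linarith) hN.t_pos.le
    exact Nat.lt_succ_iff.1 (by exact_mod_cast hlt)

theorem mul_le_encard (h : IsNotchGrid s ρ A P I J x ε y t r Y) {α : Type*} {S : Set α}
    (f : ℕ → ℕ → α) (hS : ∀ i < I, ∀ j < J, f i j ∈ S)
    (hf : ∀ i < I, ∀ j < J, ∀ i' < I, ∀ j' < J, f i j = f i' j' →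
      notchCorner (x + i * ε) ε (y + j * t) r ∈ notchRegion (x + i' * ε) ε (y + j' * t) t r) :
    ((I * J : ℕ) : ℕ∞) ≤ S.encard := by
  have hmaps : MapsTo (fun q : ℕ × ℕ => f q.1 q.2) (Iio I ×ˢ Iio J) S :=
    fun q hq => hS q.1 hq.1 q.2 hq.2
  have hinj : InjOn (fun q : ℕ × ℕ => f q.1 q.2) (Iio I ×ˢ Iio J) := by
    rintro ⟨i, j⟩ hq ⟨i', j'⟩ hq' heq
    have hle := h.le_of_notchCorner_mem_notchRegion hq.1.le hq'.1.le hq.2 hq'.2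
      (hf i hq.1 j hq.2 i' hq'.1 j' hq'.2 heq)
    have hge := h.le_of_notchCorner_mem_notchRegion hq'.1.le hq.1.le hq'.2 hq.2
      (hf i' hq'.1 j' hq'.2 i hq.1 j hq.2 heq.symm)
    exact Prod.ext (hle.1.antisymm hge.1) (hle.2.antisymm hge.2)
  have hcard : (Iio I ×ˢ Iio J).encard = (I * J : ℕ) := by
    rw [← Finset.coe_Iio, ← Finset.coe_Iio, ← Finset.coe_product, encard_coe_eq_coe_finsetCard,
      Finset.card_product, Nat.card_Iio, Nat.card_Iio]
  exact hcard ▸ Set.encard_le_encard_of_injOn hmaps hinj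

theorem mul_le_encard_cellFaces (h : IsNotchGrid s ρ A P I J x ε y t r Y) :
    ((I * J : ℕ) : ℕ∞) ≤ (cellFaces (radiiDiagram s ρ)).encard :=
  h.mul_le_encard (fun i j => notchRegion (x + i * ε) ε (y + j * t) t r)
    (fun i hi j hj => ⟨_, (h i hi.le j hj).notchRegion_mem_componentsOf⟩)
    fun i hi j hj _ _ _ _ heq => heq.subset (h i hi.le j hj).notchCorner_mem_notchRegion

theorem mul_le_encard_edges (h : IsNotchGrid s ρ A P I J x ε y t r Y) :
    ((I * J : ℕ) : ℕ∞) ≤ (edges (radiiDiagram s ρ)).encard :=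
  h.mul_le_encard (fun i j => notchArc (x + i * ε) ε (y + j * t) r)
    (fun i hi j hj => Or.inr (h i hi.le j hj).notchArc_mem_curvedEdges)
    fun i hi j hj i' hi' j' hj' heq => (h i' hi'.le j' hj').notchArc_subset_notchRegion
      (heq.subset (h i hi.le j hj).notchCorner_mem_notchArc)

theorem mul_le_encard_vertices (h : IsNotchGrid s ρ A P I J x ε y t r Y) :
    ((I * J : ℕ) : ℕ∞) ≤ (vertices (radiiDiagram s ρ)).encard :=
  h.mul_le_encard (fun i j => notchCorner (x + i * ε) ε (y + j * t) r)
    (fun i hi j hj => (h i hi.le j hj).notchCorner_mem_vertices (h.isNotch_succ hi hj))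
    fun _ _ _ _ i' hi' j' hj' heq => heq ▸ (h i' hi'.le j' hj').notchCorner_mem_notchRegion

end IsNotchGrid

end Grids

section Crowds

variable {ι : Type*} {s : ι → Plane} {ρ : ι → ℝ} {μ : Measure Plane} {a D η : ℝ} {i : ι}

theorem exists_mem_openCell_apply_notMem_Icc (hμ : μ ≤ volume) (ha : 0 < a)
    (hcell : ENNReal.ofReal a ≤ μ (openCell s ρ i)) (hD0 : 0 ≤ D) (hD : ρ i ≤ D) (c : Fin 2)
    {u w : ℝ} (hw : 2 * D * w < a) : ∃ p ∈ openCell s ρ i, p c ∉ Icc u (u + w) := by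
  by_contra! hslab
  have hle : ENNReal.ofReal a ≤ ENNReal.ofReal (2 * D * w) :=
    calc ENNReal.ofReal a ≤ volume (openCell s ρ i) := hcell.trans (hμ _)
      _ ≤ volume (ball (s i) D ∩ {p | p c ∈ Icc u (u + w)}) := measure_mono fun p hp =>
          ⟨ball_subset_ball hD (openCell_subset_ball s ρ i hp), hslab p hp⟩
      _ ≤ ENNReal.ofReal (2 * D * w) := Plane.volume_ball_inter_slab_le _ c hD0
  exact hle.not_gt ((ENNReal.ofReal_lt_ofReal_iff ha).2 hw)

variable [Finite ι]

/- If the radius of `s i` were smaller than `D`, then so would be the radii of the sites in `G`, and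
their disjoint cells would not fit into a disc of radius `D + η`. -/
theorem le_radius_of_crowd (hμ : μ ≤ volume)
    (hcell : ∀ g, ENNReal.ofReal a ≤ μ (openCell s ρ g)) {p : Plane} (hp : p ∈ openCell s ρ i)
    {G : Finset ι} (hcloser : ∀ g ∈ G, dist p (s g) < dist p (s i))
    (hη0 : 0 ≤ η) (hη : ∀ g ∈ G, dist (s g) (s i) ≤ η)
    (hcard : Real.pi * (D + η) ^ 2 < G.card * a) : D ≤ ρ i := by
  by_contra! hlt
  have hG : ∀ g ∈ G, ρ g ≤ D := fun g hg =>
    have hne : g ≠ i := fun h => (hcloser g hg).ne (by rw [h])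
    (((lt_dist_of_mem_openCell hp hne (hcloser g hg).le).trans (hcloser g hg)).trans
      (hp.1.trans hlt)).le
  have hle : ENNReal.ofReal (G.card * a) ≤ ENNReal.ofReal (Real.pi * (D + η) ^ 2) :=
    calc ENNReal.ofReal (G.card * a) = ∑ _ ∈ G, ENNReal.ofReal a := by
          rw [ENNReal.ofReal_mul G.card.cast_nonneg, ENNReal.ofReal_natCast, Finset.sum_const,
            nsmul_eq_mul]
      _ ≤ ∑ g ∈ G, μ (openCell s ρ g) := Finset.sum_le_sum fun g _ => hcell g
      _ ≤ volume (ball (s i) (D + η)) := (sum_measure_openCell_le G hG hη).trans (hμ _)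
      _ = ENNReal.ofReal (Real.pi * (D + η) ^ 2) :=
          Plane.volume_ball _ (add_nonneg (dist_nonneg.trans (hp.1.trans hlt).le) hη0)
  have hpos : 0 < G.card * a := lt_of_le_of_lt (by positivity) hcard
  exact hle.not_gt ((ENNReal.ofReal_lt_ofReal_iff hpos).2 hcard)

theorem le_radius_of_crowds (hμ : μ ≤ volume) (ha : 0 < a)
    (hcell : ∀ g, ENNReal.ofReal a ≤ μ (openCell s ρ g)) (hD : 0 ≤ D) (hη : 0 ≤ η) (c : Fin 2)
    {u w : ℝ} (hw : 2 * D * w < a) {M : ℕ} (hM : Real.pi * (D + η) ^ 2 < M * a)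
    (hcrowd : ∀ p ∈ openCell s ρ i, p c ∉ Icc u (u + w) → ∃ G : Finset ι, M ≤ G.card ∧
      ∀ g ∈ G, dist p (s g) < dist p (s i) ∧ dist (s g) (s i) ≤ η) : D ≤ ρ i := by
  by_contra! hlt
  obtain ⟨p, hp, hslab⟩ :=
    exists_mem_openCell_apply_notMem_Icc hμ ha (hcell i) hD hlt.le c (u := u) hw
  obtain ⟨G, hMG, hG⟩ := hcrowd p hp hslab
  refine hlt.not_ge (le_radius_of_crowd hμ hcell hp (fun g hg => (hG g hg).1) hη
    (fun g hg => (hG g hg).2) (hM.trans_le ?_))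
  gcongr

end Crowds

section Caps

/-- The part within distance `ρ` of `z` of the horizontal strip of width `t` centered at `z`. -/
def capStrip (z : Plane) (t ρ : ℝ) : Set Plane :=
  {p | |p 1 - z 1| < t / 2} ∩ ball z ρ

theorem isOpen_capStrip (z : Plane) (t ρ : ℝ) : IsOpen (capStrip z t ρ) :=
  (isOpen_lt (by fun_prop) (by fun_prop)).inter isOpen_ball

theorem volume_capStrip_eq (z z' : Plane) (t ρ : ℝ) :
    volume (capStrip z t ρ) = volume (capStrip z' t ρ) := by
  have hpre : capStrip z t ρ = (fun p => p + (z' - z)) ⁻¹' capStrip z' t ρ := by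
    ext p
    simp only [capStrip, mem_inter_iff, mem_ofPred_eq, mem_ball, mem_preimage, dist_eq_norm]
    congr! 2
    · simp; ring_nf
    · congr 1; abel
  rw [hpre, measure_preimage_add_right]

theorem volume_capStrip_lt (z : Plane) {t ρ r : ℝ} (ht : 0 < t) (hr : 0 < r) (hρ : ρ < r) :
    volume (capStrip z t ρ) < volume (capStrip z t r) := by
  have hinter : capStrip z t r ∩ ball z ρ = capStrip z t ρ := by
    rw [capStrip, inter_assoc, inter_eq_right.2 (ball_subset_ball hρ.le), capStrip]
  have hopen : IsOpen (capStrip z t r \ closedBall z ρ) :=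
    (isOpen_capStrip z t r).sdiff isClosed_closedBall
  have hne : (capStrip z t r \ closedBall z ρ).Nonempty := by
    obtain ⟨d, hd, hdr⟩ := exists_between (max_lt hρ hr)
    obtain ⟨hρd, hd0⟩ := max_lt_iff.1 hd
    have hdist : dist !₂[z 0 + d, z 1] z = d := by
      rw [← sq_eq_sq₀ dist_nonneg hd0.le, Plane.dist_sq]
      simp
    exact ⟨!₂[z 0 + d, z 1], ⟨by simpa using ht, hdist.trans_lt hdr⟩, by simpa [hdist] using hρd⟩
  have hfin : volume (capStrip z t ρ) ≠ ∞ :=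
    ((measure_mono inter_subset_right).trans_lt measure_ball_lt_top).ne
  calc volume (capStrip z t ρ)
      < volume (capStrip z t ρ) + volume (capStrip z t r \ closedBall z ρ) :=
        ENNReal.lt_add_right hfin (hopen.measure_pos _ hne).ne'
    _ ≤ volume (capStrip z t r ∩ ball z ρ) + volume (capStrip z t r \ ball z ρ) := by
        rw [hinter]
        gcongr
        exact ball_subset_closedBall
    _ = volume (capStrip z t r) := measure_inter_add_sdiff _ measurableSet_ball

theorem volume_capStrip_le (z : Plane) (t : ℝ) {r : ℝ} (hr : 0 ≤ r) :
    volume (capStrip z t r) ≤ ENNReal.ofReal (2 * r * t) := by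
  refine (measure_mono fun p hp => ?_).trans
    (Plane.volume_ball_inter_slab_le z 1 (u := z 1 - t / 2) hr)
  have hp' : |p 1 - z 1| < t / 2 := hp.1
  rw [abs_sub_lt_iff] at hp'
  exact ⟨hp.2, by linarith, by linarith⟩

theorem le_volume_capStrip (z : Plane) {t r : ℝ} (hr : 0 ≤ r) (htr : t ≤ r) :
    ENNReal.ofReal (3 / 2 * r * t) ≤ volume (capStrip z t r) := by
  calc ENNReal.ofReal (3 / 2 * r * t)
      = volume {p : Plane | p 0 ∈ Ioo (z 0 - 3 / 4 * r) (z 0 + 3 / 4 * r) ∧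
          p 1 ∈ Ioo (z 1 - t / 2) (z 1 + t / 2)} := by
        rw [Plane.volume_prod, Real.volume_Ioo, Real.volume_Ioo,
          ← ENNReal.ofReal_mul (by linarith)]
        congr 1
        ring
    _ ≤ volume (capStrip z t r) := by
        refine measure_mono fun p ⟨⟨h1, h2⟩, h3, h4⟩ => ?_
        have hstrip : |p 1 - z 1| < t / 2 := abs_sub_lt_iff.2 ⟨by linarith, by linarith⟩
        refine ⟨hstrip, ?_⟩
        rw [mem_ball, Plane.dist_lt_iff hr]
        nlinarith

theorem continuous_volume_capStrip (z : Plane) (r : ℝ) :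
    Continuous fun t => volume (capStrip z t r) := by
  refine continuous_iff_continuousAt.2 fun t => ?_
  refine tendsto_measure_of_ae_tendsto_indicator (B := ball z r) _
    (isOpen_capStrip z t r).measurableSet (fun t' => (isOpen_capStrip z t' r).measurableSet)
    measurableSet_ball measure_ball_lt_top.ne (Eventually.of_forall fun _ => inter_subset_right) ?_
  have hnull : volume {p : Plane | p 0 ∈ univ ∧
      p 1 ∈ ({z 1 + t / 2, z 1 - t / 2} : Set ℝ)} = 0 := by
    rw [Plane.volume_prod, (Set.toFinite {z 1 + t / 2, z 1 - t / 2}).measure_zero, mul_zero]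
  filter_upwards [compl_mem_ae_iff.2 hnull] with p hp
  have hne : |p 1 - z 1| ≠ t / 2 := fun h => hp ⟨trivial, by
    rcases abs_choice (p 1 - z 1) with h' | h'
    · left; linarith
    · right; rw [mem_singleton_iff]; linarith⟩
  have hc : ContinuousAt (fun t' : ℝ => t' / 2) t := by fun_prop
  rcases hne.lt_or_gt with h | h
  · filter_upwards [continuousAt_const.eventually_lt hc h] with t' h'
    simp [capStrip, h, h']
  · filter_upwards [hc.eventually_lt continuousAt_const h] with t' h'
    simp [capStrip, h.not_gt, h'.not_gt]

theorem exists_volume_capStrip_eq (z : Plane) {r a : ℝ} (hr : 0 < r) (ha : 0 < a)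
    (har : a ≤ 3 / 2 * r ^ 2) : ∃ t, 0 < t ∧ volume (capStrip z t r) = ENNReal.ofReal a ∧
      a ≤ 2 * r * t ∧ 3 / 2 * r * t ≤ a := by
  have hmem : ENNReal.ofReal a ∈ Icc (volume (capStrip z 0 r)) (volume (capStrip z r r)) := by
    refine ⟨(volume_capStrip_le z 0 hr.le).trans (by simp), ?_⟩
    refine le_trans ?_ (le_volume_capStrip z hr.le le_rfl)
    exact ENNReal.ofReal_le_ofReal (by linarith)
  obtain ⟨t, ⟨ht0, htr⟩, ht⟩ :=
    intermediate_value_Icc hr.le (continuous_volume_capStrip z r).continuousOn hmem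
  have hupper := volume_capStrip_le z t hr.le
  have hlower := le_volume_capStrip z hr.le htr
  rw [show volume _ = _ from ht, ENNReal.ofReal_le_ofReal_iff (by positivity)] at hupper
  rw [show volume _ = _ from ht, ENNReal.ofReal_le_ofReal_iff ha.le] at hlower
  refine ⟨t, ht0.lt_of_ne ?_, ht, hupper, hlower⟩
  rintro rfl
  linarith

end Caps

section Columns

variable {ι : Type*} {s : ι → Plane} {ρ : ι → ℝ} {a r t η : ℝ} {i j k : ι}

theorem capStrip_subset_openCell (hs : ∀ j, s j 0 = s i 0)
    (hgap : ∀ j, j ≠ i → t ≤ |s j 1 - s i 1|) : capStrip (s i) t (ρ i) ⊆ openCell s ρ i := by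
  rintro p ⟨hstrip, hball⟩
  refine ⟨hball, fun j hj => Or.inr ?_⟩
  rw [Plane.dist_lt_dist_iff_abs_sub_lt 1 (hs j).symm]
  have hstrip' : |p 1 - s i 1| < t / 2 := hstrip
  have htri := abs_sub_le (s j 1) (p 1) (s i 1)
  rw [abs_sub_comm (s j 1) (p 1)] at htri
  linarith [hgap j hj]

theorem abs_sub_lt_of_mem_openCell {p : Plane} (hp : p ∈ openCell s ρ i) (hne : j ≠ i)
    (hs : s j 0 = s i 0) (hρ : ρ i ≤ ρ j) : |p 1 - s i 1| < |p 1 - s j 1| :=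
  (Plane.dist_lt_dist_iff_abs_sub_lt 1 hs.symm).1 (dist_lt_dist_of_mem_openCell hp hne hρ)

theorem openCell_subset_capStrip (ht : 0 < t) (hsj : s j = !₂[s i 0, s i 1 - t])
    (hsk : s k = !₂[s i 0, s i 1 + t]) (hρj : ρ i ≤ ρ j) (hρk : ρ i ≤ ρ k) :
    openCell s ρ i ⊆ capStrip (s i) t (ρ i) := by
  have hne : ∀ l, s l 1 ≠ s i 1 → l ≠ i := by
    rintro l hl rfl
    exact hl rfl
  intro p hp
  have hj := abs_sub_lt_of_mem_openCell hp (hne j (by simp [hsj, ht.ne'])) (by simp [hsj]) hρj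
  have hk := abs_sub_lt_of_mem_openCell hp (hne k (by simp [hsk, ht.ne'])) (by simp [hsk]) hρk
  simp only [hsj, hsk, Matrix.cons_val_one, Matrix.cons_val_fin_one, ← sq_lt_sq] at hj hk
  have hstrip : |p 1 - s i 1| < t / 2 := abs_sub_lt_iff.2 ⟨by nlinarith, by nlinarith⟩
  exact ⟨hstrip, hp.1⟩

theorem radius_le_of_volume_le_capStrip (ht : 0 < t) (hr : 0 < r) (hs : ∀ j, s j 0 = s i 0)
    (hgap : ∀ j, j ≠ i → t ≤ |s j 1 - s i 1|)
    (hcell : volume (openCell s ρ i) ≤ volume (capStrip (s i) t r)) : ρ i ≤ r := by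
  by_contra! hlt
  exact ((volume_capStrip_lt (s i) ht (hr.trans hlt) hlt).trans_le
    (measure_mono (capStrip_subset_openCell hs hgap))).not_ge hcell

theorem le_radius_of_capStrip_le_volume (ht : 0 < t) (hr : 0 < r)
    (hsj : s j = !₂[s i 0, s i 1 - t]) (hsk : s k = !₂[s i 0, s i 1 + t]) (hρj : ρ i ≤ ρ j)
    (hρk : ρ i ≤ ρ k) (hcell : volume (capStrip (s i) t r) ≤ volume (openCell s ρ i)) :
    r ≤ ρ i := by
  by_contra! hlt
  exact ((measure_mono (openCell_subset_capStrip ht hsj hsk hρj hρk)).trans_lt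
    (volume_capStrip_lt (s i) ht hr hlt)).not_ge hcell

theorem le_radius_of_crowd_of_neighbor [Finite ι] {d : ℝ} (ha : 0 < a)
    (hcell : ∀ g, ENNReal.ofReal a ≤ volume (openCell s ρ g)) (hr : 0 ≤ r) (hη : 0 ≤ η)
    (hd : d ≠ 0) (hsj : s j = !₂[s i 0, s i 1 + d]) (hρj : ρ i ≤ ρ j) {G : Finset ι}
    (hG0 : ∀ g ∈ G, s g 0 = s i 0) (hGd : ∀ g ∈ G, d * (s g 1 - s i 1) < 0)
    (hGη : ∀ g ∈ G, |s g 1 - s i 1| ≤ η) (hw : 2 * r * (|d| / 2 + η) < a)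
    (hcard : Real.pi * (r + η) ^ 2 < G.card * a) : r ≤ ρ i := by
  have hne : j ≠ i := by
    rintro rfl
    exact hd (by simpa using congrArg (fun p : Plane => p 1) hsj)
  have hnear : ∀ p ∈ openCell s ρ i, 2 * d * (p 1 - s i 1) < d ^ 2 := fun p hp => by
    have habs := abs_sub_lt_of_mem_openCell hp hne (by simp [hsj]) hρj
    simp only [hsj, Matrix.cons_val_one, Matrix.cons_val_fin_one, ← sq_lt_sq] at habs
    linarith
  have hdist : ∀ g ∈ G, dist (s g) (s i) ≤ η := fun g hg =>
    (Plane.dist_eq_abs_sub 1 (hG0 g hg)).trans_le (hGη g hg)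
  have hside : ∀ g ∈ G, ∀ p, p 1 < s i 1 - η ∧ s g 1 < s i 1 ∨
      s i 1 + η < p 1 ∧ s i 1 < s g 1 → dist p (s g) < dist p (s i) := by
    rintro g hg p (⟨hp, hlt⟩ | ⟨hp, hlt⟩) <;> have hg' := abs_le.1 (hGη g hg)
    · exact Plane.dist_lt_dist_of_le_of_lt 1 (hG0 g hg) (by linarith) hlt
    · exact Plane.dist_lt_dist_of_lt_of_le 1 (hG0 g hg) hlt (by linarith)
  rcases hd.lt_or_gt with hd | hd
  · rw [abs_of_neg hd] at hw
    refine le_radius_of_crowds le_rfl ha hcell hr hη 1 hw (u := s i 1 + d / 2) hcard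
      fun p hp hslab => ⟨G, le_rfl, fun g hg => ⟨hside g hg p (Or.inr ⟨?_, ?_⟩), hdist g hg⟩⟩
    · by_contra! hle
      exact hslab ⟨by nlinarith [hnear p hp], by linarith⟩
    · nlinarith [hGd g hg]
  · rw [abs_of_pos hd, add_comm] at hw
    refine le_radius_of_crowds le_rfl ha hcell hr hη 1 hw (u := s i 1 - η) hcard
      fun p hp hslab => ⟨G, le_rfl, fun g hg => ⟨hside g hg p (Or.inl ⟨?_, ?_⟩), hdist g hg⟩⟩
    · by_contra! hle
      exact hslab ⟨hle, by nlinarith [hnear p hp]⟩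
    · nlinarith [hGd g hg]

end Columns

section ColumnSites

/-- The indices of the sites of a column: `m + 1` sites that form an arithmetic progression, and two
clusters of `K` sites each at its lower and at its upper end. -/
abbrev ColumnIndex (m K : ℕ) : Type := Fin (m + 1) ⊕ Fin K ⊕ Fin K

/-- The ordinates of the sites of a column: the progression starts at `0` and has difference `t`;
consecutive sites of the clusters have distance `e`. -/
def columnHeight (m K : ℕ) (t e : ℝ) : ColumnIndex m K → ℝ
  | .inl k => k * t
  | .inr (.inl g) => -((g + 1) * e)
  | .inr (.inr g) => m * t + (g + 1) * e

/-- The sites of a column, which lie on the vertical axis. -/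
noncomputable def columnSite (m K : ℕ) (t e : ℝ) (i : ColumnIndex m K) : Plane :=
  !₂[0, columnHeight m K t e i]

variable {m K : ℕ} {t e : ℝ}

theorem cluster_offset_mem_Ioc (he : 0 < e) (g : Fin K) : ((g : ℝ) + 1) * e ∈ Ioc 0 (K * e) :=
  ⟨by positivity, by gcongr; exact_mod_cast g.2⟩

theorem columnHeight_le (ht : 0 < t) (he : 0 < e) (i : ColumnIndex m K) :
    columnHeight m K t e i ≤ m * t + K * e := by
  have hm : 0 ≤ m * t := by positivity
  rcases i with k | g | g
  · have hk : (k : ℝ) * t ≤ m * t := by gcongr; exact_mod_cast Nat.lt_succ_iff.1 k.2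
    exact hk.trans (le_add_of_nonneg_right (by positivity))
  · have hg := cluster_offset_mem_Ioc he g
    simp only [columnHeight]
    linarith [hg.1, hg.2]
  · exact add_le_add_right (cluster_offset_mem_Ioc he g).2 _

theorem columnHeight_nonpos_or_ge_or_exists (he : 0 < e) (i : ColumnIndex m K) :
    columnHeight m K t e i ≤ 0 ∨ m * t ≤ columnHeight m K t e i ∨
      ∃ k : Fin (m + 1), 0 < (k : ℕ) ∧ (k : ℕ) < m ∧ i = .inl k := by
  rcases i with k | g | g
  · rcases (k : ℕ).eq_zero_or_pos with h0 | h0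
    · exact Or.inl (by simp [columnHeight, h0])
    rcases (Nat.lt_succ_iff.1 k.2).eq_or_lt with hm | hm
    · exact Or.inr (Or.inl (by simp [columnHeight, hm]))
    · exact Or.inr (Or.inr ⟨k, h0, hm, rfl⟩)
  · exact Or.inl (neg_nonpos.2 (cluster_offset_mem_Ioc he g).1.le)
  · exact Or.inr (Or.inl (le_add_of_nonneg_right (cluster_offset_mem_Ioc he g).1.le))

theorem columnHeight_add_le_or_add_le (ht : 0 < t) (he : 0 < e) {k : Fin (m + 1)}
    (hk0 : 0 < (k : ℕ)) (hkm : (k : ℕ) < m) {i : ColumnIndex m K} (hi : i ≠ .inl k) :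
    columnHeight m K t e i + t ≤ k * t ∨ k * t + t ≤ columnHeight m K t e i := by
  have hstep : ∀ {l l' : ℕ}, l < l' → (l : ℝ) * t + t ≤ l' * t := fun {l l'} h => by
    rw [← add_one_mul]
    gcongr
    exact_mod_cast h
  rcases i with l | g | g
  · rcases lt_or_gt_of_ne fun h : (l : ℕ) = k => hi (congrArg _ (Fin.ext h)) with h | h
    · exact Or.inl (hstep h)
    · exact Or.inr (hstep h)
  · left
    have h0 := hstep hk0
    rw [Nat.cast_zero, zero_mul, zero_add] at h0
    simp only [columnHeight]
    linarith [(cluster_offset_mem_Ioc he g).1]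
  · exact Or.inr ((hstep hkm).trans
      (le_add_of_nonneg_right (cluster_offset_mem_Ioc he g).1.le))

theorem le_abs_columnHeight_sub (ht : 0 < t) (he : 0 < e) {k : Fin (m + 1)} (hk0 : 0 < (k : ℕ))
    (hkm : (k : ℕ) < m) {i : ColumnIndex m K} (hi : i ≠ .inl k) :
    t ≤ |columnHeight m K t e i - columnHeight m K t e (.inl k)| := by
  rcases columnHeight_add_le_or_add_le ht he hk0 hkm hi with h | h
  · exact le_abs.2 (Or.inr (by simp only [columnHeight] at *; linarith))
  · exact le_abs.2 (Or.inl (by simp only [columnHeight] at *; linarith))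

theorem injective_columnSite (ht : 0 < t) (he : 0 < e) :
    Function.Injective (columnSite m K t e) := by
  intro i j h
  have hheight : columnHeight m K t e i = columnHeight m K t e j :=
    congrArg (fun p : Plane => p 1) h
  have hprog : ∀ k : Fin (m + 1), (k : ℝ) * t ∈ Icc 0 (m * t) := fun k =>
    ⟨by positivity, by gcongr; exact_mod_cast Nat.lt_succ_iff.1 k.2⟩
  have hcluster := fun g : Fin K => (cluster_offset_mem_Ioc he g).1
  have hm : 0 ≤ m * t := by positivity
  rcases i with k | g | g <;> rcases j with k' | g' | g' <;> simp only [columnHeight] at hheight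
  · simpa [ht.ne', Fin.val_inj] using hheight
  · linarith [(hprog k).1, hcluster g']
  · linarith [(hprog k).2, hcluster g']
  · linarith [(hprog k').1, hcluster g]
  · simpa [he.ne', Fin.val_inj] using hheight
  · linarith [hcluster g, hcluster g']
  · linarith [(hprog k').2, hcluster g]
  · linarith [hcluster g, hcluster g']
  · simpa [he.ne', Fin.val_inj] using hheight

variable {ρ : ColumnIndex m K → ℝ} {a r R : ℝ}

theorem le_radius_column_zero (ha : 0 < a)
    (hcell : ∀ i, volume (openCell (columnSite m K t e) ρ i) = ENNReal.ofReal a) (hm : 0 < m)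
    (hr : 0 ≤ r) (ht : 0 < t) (he : 0 < e) (hw : 2 * r * (t / 2 + K * e) < a)
    (hcard : Real.pi * (r + K * e) ^ 2 < K * a)
    (hmin : ∀ k, ρ (.inl 0) ≤ ρ (.inl k)) : r ≤ ρ (.inl 0) := by
  have hoffset : ∀ g : Fin K, columnSite m K t e (.inr (.inl g)) 1 -
      columnSite m K t e (.inl 0) 1 = -((g + 1) * e) := fun g => by
    simp [columnSite, columnHeight]
  refine le_radius_of_crowd_of_neighbor (j := .inl ⟨1, by omega⟩) ha (fun g => (hcell g).ge) hr
    (η := K * e) (by positivity) ht.ne' ?_ (hmin _)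
    (G := Finset.univ.map (Function.Embedding.inl.trans Function.Embedding.inr))
    (Finset.forall_mem_map.2 fun _ _ => rfl) (Finset.forall_mem_map.2 fun g _ => ?_)
    (Finset.forall_mem_map.2 fun g _ => ?_) (by rwa [abs_of_pos ht]) (by simpa using hcard)
  · simp [columnSite, columnHeight]
  · exact (congrArg (t * ·) (hoffset g)).trans_lt
      (mul_neg_of_pos_of_neg ht (neg_neg_of_pos (cluster_offset_mem_Ioc he g).1))
  · have hg := cluster_offset_mem_Ioc he g
    exact (congrArg abs (hoffset g)).trans_le (by rw [abs_neg, abs_of_pos hg.1]; exact hg.2)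

theorem le_radius_column_last (ha : 0 < a)
    (hcell : ∀ i, volume (openCell (columnSite m K t e) ρ i) = ENNReal.ofReal a) (hm : 0 < m)
    (hr : 0 ≤ r) (ht : 0 < t) (he : 0 < e) (hw : 2 * r * (t / 2 + K * e) < a)
    (hcard : Real.pi * (r + K * e) ^ 2 < K * a)
    (hmin : ∀ k, ρ (.inl (Fin.last m)) ≤ ρ (.inl k)) : r ≤ ρ (.inl (Fin.last m)) := by
  have hoffset : ∀ g : Fin K, columnSite m K t e (.inr (.inr g)) 1 -
      columnSite m K t e (.inl (Fin.last m)) 1 = (g + 1) * e := fun g => by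
    simp [columnSite, columnHeight]
  refine le_radius_of_crowd_of_neighbor (j := .inl ⟨m - 1, by omega⟩) ha (fun g => (hcell g).ge) hr
    (η := K * e) (by positivity) (neg_ne_zero.2 ht.ne') ?_ (hmin _)
    (G := Finset.univ.map (Function.Embedding.inr.trans Function.Embedding.inr))
    (Finset.forall_mem_map.2 fun _ _ => rfl) (Finset.forall_mem_map.2 fun g _ => ?_)
    (Finset.forall_mem_map.2 fun g _ => ?_) (by rwa [abs_neg, abs_of_pos ht])
    (by simpa using hcard)
  · simp [columnSite, columnHeight, Nat.cast_sub (Nat.one_le_iff_ne_zero.2 hm.ne'),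
      sub_eq_add_neg, add_mul]
  · exact (congrArg (-t * ·) (hoffset g)).trans_lt
      (mul_neg_of_neg_of_pos (neg_neg_of_pos ht) (cluster_offset_mem_Ioc he g).1)
  · have hg := cluster_offset_mem_Ioc he g
    exact (congrArg abs (hoffset g)).trans_le (by rw [abs_of_pos hg.1]; exact hg.2)

theorem le_radius_column (ha : 0 < a)
    (hcell : ∀ i, volume (openCell (columnSite m K t e) ρ i) = ENNReal.ofReal a) (hm : 0 < m)
    (hr : 0 < r) (ht : 0 < t) (he : 0 < e) (hw : 2 * r * (t / 2 + K * e) < a)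
    (hcard : Real.pi * (r + K * e) ^ 2 < K * a)
    (hcap : ∀ z, volume (capStrip z t r) = ENNReal.ofReal a) (k : Fin (m + 1)) :
    r ≤ ρ (.inl k) := by
  obtain ⟨k₀, hmin⟩ := Finite.exists_min fun k : Fin (m + 1) => ρ (.inl k)
  refine le_trans ?_ (hmin k)
  rcases eq_or_ne k₀ 0 with rfl | h0
  · exact le_radius_column_zero ha hcell hm hr.le ht he hw hcard hmin
  rcases eq_or_ne k₀ (Fin.last m) with rfl | hlast
  · exact le_radius_column_last ha hcell hm hr.le ht he hw hcard hmin
  have hk0 : 1 ≤ (k₀ : ℕ) := Nat.one_le_iff_ne_zero.2 (Fin.val_ne_zero_iff.2 h0)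
  have hkm : (k₀ : ℕ) < m := Fin.val_lt_last hlast
  refine le_radius_of_capStrip_le_volume (j := .inl ⟨k₀ - 1, by omega⟩)
    (k := .inl ⟨k₀ + 1, by omega⟩) ht hr ?_ ?_ (hmin _) (hmin _) ((hcap _).trans_le (hcell _).ge)
  · simp [columnSite, columnHeight, Nat.cast_sub hk0, sub_mul]
  · simp [columnSite, columnHeight, add_mul]

theorem radius_column_eq (ha : 0 < a)
    (hcell : ∀ i, volume (openCell (columnSite m K t e) ρ i) = ENNReal.ofReal a)
    (hr : 0 < r) (ht : 0 < t) (he : 0 < e) (hw : 2 * r * (t / 2 + K * e) < a)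
    (hcard : Real.pi * (r + K * e) ^ 2 < K * a)
    (hcap : ∀ z, volume (capStrip z t r) = ENNReal.ofReal a) {k : Fin (m + 1)}
    (hk0 : 0 < (k : ℕ)) (hkm : (k : ℕ) < m) : ρ (.inl k) = r :=
  (radius_le_of_volume_le_capStrip ht hr (fun _ => rfl)
    (fun _ hj => le_abs_columnHeight_sub ht he hk0 hkm hj)
    ((hcell _).trans_le (hcap _).ge)).antisymm
      (le_radius_column ha hcell (hk0.trans hkm) hr ht he hw hcard hcap k)

end ColumnSites

section Layers

variable {E ι : Type*} [NormedAddCommGroup E] [InnerProductSpace ℝ E] [FiniteDimensional ℝ E]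
  [Nontrivial E] [MeasurableSpace E] [BorelSpace E] {μ ν : Measure E} [ν.IsAddHaarMeasure]
  {s : ι → E}

theorem exists_radii_of_le_addHaar [Finite ι] (hμ : μ ≤ ν) (hμ_top : μ univ = ∞)
    (hs : Function.Injective s) (A : ι → ℝ) :
    ∃ ρ : ι → ℝ, ∀ i, μ (openCell s ρ i) = ENNReal.ofReal (A i) := by
  have := Fintype.ofFinite ι
  have : IsFiniteMeasureOnCompacts μ := ⟨fun _ hK => (hμ _).trans_lt hK.measure_lt_top⟩
  refine exists_radii (fun ρ => le_antisymm ((hμ _).trans (addHaar_walls ν hs ρ).le) zero_le) ?_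
  rw [hμ_top]
  exact ENNReal.sum_lt_top.2 fun _ _ => ENNReal.ofReal_lt_top

end Layers

theorem volume_plane_univ : volume (univ : Set Plane) = ∞ :=
  have : NoncompactSpace Plane := NormedSpace.noncompactSpace ℝ Plane
  measure_univ_of_isAddLeftInvariant _

theorem radius_le_of_card_mul_le {ι : Type*} [Fintype ι] {s : ι → Plane} {ρ : ι → ℝ} {a R : ℝ}
    (hs : Function.Injective s) (ha : 0 ≤ a)
    (hcell : ∀ i, volume (openCell s ρ i) = ENNReal.ofReal a) (hR : 0 ≤ R)
    (hcard : Fintype.card ι * a ≤ Real.pi * R ^ 2) (i : ι) : ρ i ≤ R := by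
  by_contra! hlt
  have hi : 0 ≤ ρ i := hR.trans hlt.le
  have hball := measure_ball_le_sum_openCell (addHaar_walls volume hs ρ) i
  simp only [Plane.volume_ball _ hi, hcell, Finset.sum_const, Finset.card_univ, nsmul_eq_mul,
    ← ENNReal.ofReal_natCast, ← ENNReal.ofReal_mul (Nat.cast_nonneg (Fintype.card ι))] at hball
  have hle : Real.pi * ρ i ^ 2 ≤ Real.pi * R ^ 2 :=
    ((ENNReal.ofReal_le_ofReal_iff (by positivity)).1 hball).trans hcard
  exact hle.not_gt (by gcongr)

section Rows

/-- The sites of a row: `q` points at the height `Y`, with spacing `ε`. -/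
noncomputable def rowSite (q : ℕ) (x ε Y : ℝ) (i : Fin q) : Plane := !₂[x + i * ε, Y]

variable {q : ℕ} {x ε Y : ℝ}

theorem le_abs_rowSite_sub (hε : 0 ≤ ε) {i j : Fin q} (hij : j ≠ i) :
    ε ≤ |rowSite q x ε Y j 0 - rowSite q x ε Y i 0| := by
  have hone : (1 : ℝ) ≤ |(j : ℝ) - i| := by
    have : (1 : ℤ) ≤ |(j : ℤ) - i| := Int.one_le_abs (by omega)
    exact_mod_cast this
  calc ε ≤ |(j : ℝ) - i| * ε := le_mul_of_one_le_left hε hone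
    _ = |rowSite q x ε Y j 0 - rowSite q x ε Y i 0| := by
      simp only [rowSite, Matrix.cons_val_zero, add_sub_add_left_eq_sub, ← sub_mul, abs_mul,
        abs_of_nonneg hε]

theorem injective_rowSite (hε : 0 < ε) : Function.Injective (rowSite q x ε Y) := by
  intro i j h
  by_contra hij
  exact hε.not_ge ((le_abs_rowSite_sub hε.le hij).trans (by rw [h, sub_self, abs_zero]))

theorem rowSite_apply_zero_mem_Icc (hε : 0 ≤ ε) (i : Fin q) :
    rowSite q x ε Y i 0 ∈ Icc x (x + q * ε) :=
  ⟨le_add_of_nonneg_right (by positivity), add_le_add_right (by gcongr; exact_mod_cast i.2.le) x⟩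

theorem dist_rowSite_lt {r D : ℝ} (hx : 0 ≤ x) (hε : 0 ≤ ε) (hxr : x + q * ε ≤ r) (hD0 : 0 ≤ D)
    (hD : r ^ 2 + Y ^ 2 < D ^ 2) {p : Plane} (hp0 : p 0 ∈ Icc 0 r) (hp1 : p 1 ∈ Icc 0 Y)
    (i : Fin q) : dist p (rowSite q x ε Y i) < D := by
  have hmem := rowSite_apply_zero_mem_Icc (x := x) (Y := Y) hε i
  have h0 : (p 0 - rowSite q x ε Y i 0) ^ 2 ≤ r ^ 2 :=
    sq_le_sq' (by linarith [hp0.1, hmem.2]) (by linarith [hp0.2, hmem.1])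
  have h1 : (p 1 - Y) ^ 2 ≤ Y ^ 2 := sq_le_sq' (by linarith [hp1.1]) (by linarith [hp1.1, hp1.2])
  exact (Plane.dist_lt_iff hD0).2 ((add_le_add h0 h1).trans_lt hD)

theorem le_radius_row {μ : Measure Plane} {ρ : Fin q → ℝ} {a D : ℝ} {M : ℕ} {i : Fin q}
    (hμ : μ ≤ volume) (ha : 0 < a)
    (hcell : ∀ g, ENNReal.ofReal a ≤ μ (openCell (rowSite q x ε Y) ρ g)) (hε : 0 < ε) (hD : 0 ≤ D)
    (hw : 2 * D * (2 * (q * ε)) < a) (hM : Real.pi * (D + q * ε) ^ 2 < M * a) (hMi : M ≤ i)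
    (hiM : i + M < q) : D ≤ ρ i := by
  have hmem := rowSite_apply_zero_mem_Icc (q := q) (x := x) (Y := Y) hε.le
  have hmono : ∀ {g g' : Fin q}, g < g' → rowSite q x ε Y g 0 < rowSite q x ε Y g' 0 :=
    fun h => add_lt_add_right (by gcongr; exact_mod_cast h) x
  have hdist : ∀ g, dist (rowSite q x ε Y g) (rowSite q x ε Y i) ≤ q * ε := fun g => by
    refine (Plane.dist_eq_abs_sub 0 (by simp [rowSite])).trans_le (abs_sub_le_iff.2 ⟨?_, ?_⟩)
    · linarith [(hmem g).2, (hmem i).1]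
    · linarith [(hmem g).1, (hmem i).2]
  refine le_radius_of_crowds hμ ha hcell hD (by positivity) 0 hw
    (u := rowSite q x ε Y i 0 - q * ε) hM fun p _ hslab => ?_
  rcases lt_or_ge (p 0) (rowSite q x ε Y i 0 - q * ε) with hp | hp
  · refine ⟨Finset.Iio i, by rwa [Fin.card_Iio], fun g hg =>
      ⟨Plane.dist_lt_dist_of_le_of_lt 0 rfl ?_ (hmono (Finset.mem_Iio.1 hg)), hdist g⟩⟩
    linarith [(hmem g).1, (hmem i).2]
  · refine ⟨Finset.Ioi i, by rw [Fin.card_Ioi]; omega, fun g hg =>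
      ⟨Plane.dist_lt_dist_of_lt_of_le 0 rfl (hmono (Finset.mem_Ioi.1 hg)) ?_, hdist g⟩⟩
    have hp' : rowSite q x ε Y i 0 - q * ε + 2 * (q * ε) < p 0 :=
      not_le.1 fun h => hslab ⟨hp, h⟩
    linarith [(hmem g).2, (hmem i).1]

theorem exists_radii_row {ι : Type*} [Finite ι] {s : ι → Plane} {ρ : ι → ℝ} {a D : ℝ} {M : ℕ}
    (ha : 0 < a) (hcell : ∀ i, volume (openCell s ρ i) = ENNReal.ofReal a)
    (hsep : ∀ i p, dist p (s i) ≤ ρ i → ∀ k, dist p (s i) < dist p (rowSite q x ε Y k))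
    (hε : 0 < ε) (hD : 0 ≤ D) (hw : 2 * D * (2 * (q * ε)) < a)
    (hM : Real.pi * (D + q * ε) ^ 2 < M * a) :
    ∃ ρ' : Fin q → ℝ, (∀ o, volume (openCell (Sum.elim s (rowSite q x ε Y)) (Sum.elim ρ ρ') o) =
      ENNReal.ofReal a) ∧ ∀ i : Fin q, M ≤ (i : ℕ) → (i : ℕ) + M < q → D ≤ ρ' i := by
  obtain ⟨ρ', hcell'⟩ := exists_radii_of_le_addHaar
    (Measure.restrict_le_self (s := openUnmatched s ρ))
    (by rw [Measure.restrict_apply_univ, measure_openUnmatched_eq_top volume_plane_univ])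
    (injective_rowSite (q := q) (x := x) (Y := Y) hε) fun _ => a
  refine ⟨ρ', fun o => ?_, fun i hMi hiM => le_radius_row Measure.restrict_le_self ha
    (fun g => (hcell' g).ge) hε hD hw hM hMi hiM⟩
  rw [measure_openCell_elim hsep]
  rcases o with i | k
  · exact hcell i
  · exact hcell' k

end Rows

section ColumnsAndRows

variable {m K q : ℕ} {t e r R x ε Y : ℝ} {ρ₁ : ColumnIndex m K → ℝ} {ρ₂ : Fin q → ℝ}

/-- The radii `ρ` are at most `R`, and they all equal `r` at the interior sites of the progression
of a column. -/
structure IsRegularColumn (t e r R : ℝ) (ρ : ColumnIndex m K → ℝ) : Prop where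
  t_pos : 0 < t
  e_pos : 0 < e
  radius_eq : ∀ k : Fin (m + 1), 0 < (k : ℕ) → (k : ℕ) < m → ρ (.inl k) = r
  radius_le : ∀ i, ρ i ≤ R

namespace IsRegularColumn

theorem mem_openCell (h : IsRegularColumn t e r R ρ₁) {k : Fin (m + 1)} (hk0 : 0 < (k : ℕ))
    (hkm : (k : ℕ) < m) {p : Plane} (hball : dist p (columnSite m K t e (.inl k)) < r)
    (hstrip : |p 1 - k * t| < t / 2) : p ∈ openCell (columnSite m K t e) ρ₁ (.inl k) :=
  capStrip_subset_openCell (t := t) (fun _ => rfl)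
    (fun _ hj => le_abs_columnHeight_sub h.t_pos h.e_pos hk0 hkm hj)
    ⟨hstrip, by rwa [h.radius_eq k hk0 hkm]⟩

theorem radius_lt_dist (h : IsRegularColumn t e r R ρ₁) (hr : 0 ≤ r) (hpos : 0 < x - ε)
    (hgap : r ^ 2 < (x - ε) ^ 2 + (t / 2) ^ 2) {k l : Fin (m + 1)} (hk0 : 0 < (k : ℕ))
    (hkl : (l : ℕ) = k + 1) (hlm : (l : ℕ) < m) (hRk : R < k * t) (hRl : l * t + R < m * t)
    {p : Plane} (hp : p ∈ notchBox x ε (k * t) t) {j : ColumnIndex m K} (hjk : j ≠ .inl k)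
    (hjl : j ≠ .inl l) : ρ₁ j < dist p (columnSite m K t e j) := by
  have hl : (l : ℝ) * t = k * t + t := by rw [hkl]; push_cast; ring
  have hvert : |p 1 - columnHeight m K t e j| ≤ dist p (columnSite m K t e j) :=
    Plane.abs_sub_le_dist p (columnSite m K t e j) 1
  obtain ⟨hp0, hp1⟩ := hp
  rcases columnHeight_nonpos_or_ge_or_exists (t := t) (m := m) h.e_pos j with
    hlow | hhigh | ⟨j, hj0, hjm, rfl⟩
  · linarith [h.radius_le j, le_abs_self (p 1 - columnHeight m K t e j), hp1.1]
  · linarith [h.radius_le j, neg_le_abs (p 1 - columnHeight m K t e j), hp1.2]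
  have hhalf : t / 2 ≤ |p 1 - j * t| := by
    have hk := columnHeight_add_le_or_add_le h.t_pos h.e_pos hk0 (by omega) hjk
    have hl' := columnHeight_add_le_or_add_le h.t_pos h.e_pos (by omega) hlm hjl
    simp only [columnHeight] at hk hl'
    rcases hk with hk | hk
    · linarith [le_abs_self (p 1 - j * t), hp1.1, h.t_pos]
    rcases hl' with hl' | hl'
    · linarith [h.t_pos]
    · linarith [neg_le_abs (p 1 - j * t), hp1.2, h.t_pos]
  have hx : (x - ε) ^ 2 ≤ p 0 ^ 2 := by gcongr; exact hp0.1
  have ht : (t / 2) ^ 2 ≤ (p 1 - j * t) ^ 2 := by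
    rw [← sq_abs (p 1 - j * t)]
    gcongr
    exact (half_pos h.t_pos).le
  rw [h.radius_eq j hj0 hjm, Plane.lt_dist_iff hr]
  simp only [columnSite, columnHeight, Matrix.cons_val_zero, Matrix.cons_val_one,
    Matrix.cons_val_fin_one, sub_zero]
  linarith

theorem isNotch_elim (h : IsRegularColumn t e r R ρ₁)
    (hsep : ∀ i p, dist p (columnSite m K t e i) ≤ ρ₁ i →
      ∀ k, dist p (columnSite m K t e i) < dist p (rowSite q x ε Y k)) {i : Fin q}
    (hi0 : 0 < (i : ℕ)) (hiq : (i : ℕ) + 1 < q) {k l : Fin (m + 1)} (hk0 : 0 < (k : ℕ))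
    (hkl : (l : ℕ) = k + 1) (hlm : (l : ℕ) < m) (hRk : R < k * t) (hRl : l * t + R < m * t)
    (hshape : IsNotchShape (x + i * ε) ε t r)
    (hreach : ∀ j : Fin q, (i : ℕ) ≤ j + 1 → (j : ℕ) ≤ i + 1 →
      ∀ p ∈ notchBox (x + i * ε) ε (k * t) t, dist p (rowSite q x ε Y j) < ρ₂ j) :
    IsNotch (Sum.elim (columnSite m K t e) (rowSite q x ε Y)) (Sum.elim ρ₁ ρ₂)
      (.inr i) (.inl (.inl k)) (.inl (.inl l)) (x + i * ε) ε (k * t) t r Y where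
  toIsNotchShape := hshape
  site_A := rfl
  site_P := rfl
  site_Q := by simp [columnSite, columnHeight, hkl, add_mul]
  radius_P := h.radius_eq k hk0 (by omega)
  radius_Q := h.radius_eq l (by omega) hlm
  reach := hreach i (by omega) (by omega)
  left := by
    refine ⟨.inr ⟨i - 1, by omega⟩, ?_, hreach _ (by grind) (by grind)⟩
    simp [rowSite, Nat.cast_sub (Nat.one_le_iff_ne_zero.2 hi0.ne'), sub_mul, add_sub_assoc]
  right := by
    refine ⟨.inr ⟨i + 1, hiq⟩, ?_, hreach _ (by grind) (by grind)⟩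
    simp [rowSite, add_mul, add_assoc]
  others := by
    rintro (j | j) hjA hjP hjQ
    · exact Or.inl fun p hp => h.radius_lt_dist hshape.r_pos.le hshape.pos hshape.gap hk0 hkl hlm
        hRk hRl hp (ne_of_apply_ne _ hjP) (ne_of_apply_ne _ hjQ)
    · exact Or.inr ⟨rfl, le_abs_rowSite_sub hshape.ε_pos.le (ne_of_apply_ne _ hjA)⟩
  prefer_P p hp := hsep (.inl k) p (hp.le.trans (h.radius_eq k hk0 (by omega)).ge) i
  prefer_Q p hp := hsep (.inl l) p (hp.le.trans (h.radius_eq l (by omega) hlm).ge) i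
  strip p hball hstrip := by
    rw [openCell_elim_inl fun i p hp => hsep i p hp.le]
    exact h.mem_openCell hk0 (by omega) hball hstrip

theorem dist_columnSite_lt_dist_rowSite (h : IsRegularColumn t e r R ρ₁)
    (hY : m * t + K * e + 2 * R < Y) {i : ColumnIndex m K} {p : Plane}
    (hp : dist p (columnSite m K t e i) ≤ ρ₁ i) (k : Fin q) :
    dist p (columnSite m K t e i) < dist p (rowSite q x ε Y k) := by
  have hvert : |columnHeight m K t e i - Y| ≤
      dist (columnSite m K t e i) (rowSite q x ε Y k) :=
    Plane.abs_sub_le_dist (columnSite m K t e i) (rowSite q x ε Y k) 1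
  have htri := dist_triangle_left (columnSite m K t e i) (rowSite q x ε Y k) p
  linarith [columnHeight_le h.t_pos h.e_pos i, h.radius_le i,
    neg_le_abs (columnHeight m K t e i - Y)]

theorem injective_elim (h : IsRegularColumn t e r R ρ₁) (hε : 0 < ε) (hY : m * t + K * e < Y) :
    Function.Injective (Sum.elim (columnSite m K t e) (rowSite q x ε Y)) := by
  refine (injective_columnSite h.t_pos h.e_pos).sumElim (injective_rowSite hε) fun i k heq => ?_
  have hheight : columnHeight m K t e i = Y := congrArg (fun p : Plane => p 1) heq
  exact ((columnHeight_le h.t_pos h.e_pos i).trans_lt hY).ne hheight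

theorem isNotchGrid_elim (h : IsRegularColumn t e r R ρ₁)
    (hY : m * t + K * e + 2 * R < Y) {D : ℝ} {M I J k₀ : ℕ} [NeZero q]
    (hk₀ : 0 < k₀) (hkm : k₀ + J < m) (hR : R < k₀ * t) (hRm : (k₀ + J) * t + R < m * t)
    (hq : M + 1 + I + M + 1 < q) (hshape : ∀ i ≤ q, IsNotchShape (x + i * ε) ε t r)
    (hradius : ∀ i : Fin q, M ≤ (i : ℕ) → (i : ℕ) + M < q → D ≤ ρ₂ i)
    (hreach : ∀ p : Plane, p 0 ∈ Icc 0 r → p 1 ∈ Icc 0 (m * t) →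
      ∀ j, dist p (rowSite q x ε Y j) < D) :
    IsNotchGrid (Sum.elim (columnSite m K t e) (rowSite q x ε Y)) (Sum.elim ρ₁ ρ₂)
      (fun i => .inr (Fin.ofNat q (M + 1 + i))) (fun j => .inl (.inl (Fin.ofNat (m + 1) (k₀ + j))))
      I J (x + (M + 1) * ε) ε (k₀ * t) t r Y := by
  intro i hi j hj
  have hival : ((Fin.ofNat q (M + 1 + i) : Fin q) : ℕ) = M + 1 + i :=
    Nat.mod_eq_of_lt (by omega)
  have hkval : ∀ l ≤ J, ((Fin.ofNat (m + 1) (k₀ + l) : Fin (m + 1)) : ℕ) = k₀ + l := fun l hl =>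
    Nat.mod_eq_of_lt (by omega)
  have hx : x + (M + 1) * ε + i * ε = x + (Fin.ofNat q (M + 1 + i) : Fin q) * ε := by
    rw [hival]; push_cast; ring
  have hy : k₀ * t + j * t = (Fin.ofNat (m + 1) (k₀ + j) : Fin (m + 1)) * t := by
    rw [hkval j hj.le]; push_cast; ring
  have hshape' := hshape _ (Fin.ofNat q (M + 1 + i)).2.le
  have hjJ : ((j : ℝ) + 1) * t ≤ J * t :=
    mul_le_mul_of_nonneg_right (by exact_mod_cast hj) h.t_pos.le
  have hJm : ((k₀ : ℝ) + J) * t ≤ m * t :=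
    mul_le_mul_of_nonneg_right (by exact_mod_cast hkm.le) h.t_pos.le
  have hjt : 0 ≤ j * t := mul_nonneg j.cast_nonneg h.t_pos.le
  have hk₀t : 0 ≤ k₀ * t := mul_nonneg k₀.cast_nonneg h.t_pos.le
  rw [hx, hy]
  refine h.isNotch_elim (fun _ _ hp => h.dist_columnSite_lt_dist_rowSite hY hp) (by omega)
    (by omega) (by rw [hkval j hj.le]; omega) (by rw [hkval j hj.le, hkval _ hj]; omega)
    (by rw [hkval _ hj]; omega) (by linarith) ?_ hshape' fun l hl hl' p hp =>
      (hreach p ?_ ?_ l).trans_le (hradius l (by omega) (by omega))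
  · rw [hkval _ hj]
    push_cast
    linarith
  · exact ⟨hshape'.pos.le.trans hp.1.1, hp.1.2.trans hshape'.lt.le⟩
  · rw [← hy] at hp
    exact ⟨by linarith [hp.2.1], hp.2.2.trans (by linarith)⟩

end IsRegularColumn

end ColumnsAndRows

section Constants

/- Areas are compared in units of `r ^ 2 = h * a`. A disc of radius slightly larger than `r` has no
room for `5 * h` cells of area `a`, a disc of radius `5 * r` has room for the whole column, and a
disc of radius `41 * r` has no room for `5300 * h` cells. -/
theorem exists_isRegularColumn {h : ℕ} (hh : 0 < h) {a r : ℝ} (ha : 0 < a) (hr : 0 < r)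
    (hra : r ^ 2 = h * a) :
    ∃ (t e : ℝ) (ρ : ColumnIndex (40 * h) (5 * h) → ℝ), IsRegularColumn t e r (5 * r) ρ ∧
      r ≤ 2 * h * t ∧ 3 * h * t ≤ 2 * r ∧ (5 * h : ℕ) * e ≤ r ∧
      ∀ i, volume (openCell (columnSite (40 * h) (5 * h) t e) ρ i) = ENNReal.ofReal a := by
  have hh1 : (1 : ℝ) ≤ h := by exact_mod_cast hh
  obtain ⟨t, ht, hcap, hta, hat⟩ := exists_volume_capStrip_eq 0 hr ha (by nlinarith)
  have hrt : r ≤ 2 * h * t := le_of_mul_le_mul_left (by nlinarith : r * r ≤ r * (2 * h * t)) hr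
  have htr : 3 * h * t ≤ 2 * r :=
    le_of_mul_le_mul_left (by nlinarith : r * (3 * h * t) ≤ r * (2 * r)) hr
  have he : 0 < r / (60 * (h : ℝ) ^ 2) := by positivity
  have hη : ((5 * h : ℕ) : ℝ) * (r / (60 * h ^ 2)) = r / (12 * h) := by
    push_cast; field_simp; norm_num
  have hη_le : r / (12 * h) ≤ r / 12 := by gcongr; linarith
  have hinj := injective_columnSite (m := 40 * h) (K := 5 * h) ht he
  obtain ⟨ρ, hcell⟩ := exists_radii_of_le_addHaar le_rfl volume_plane_univ hinj fun _ => a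
  refine ⟨t, _, ρ, ⟨ht, he, fun k hk0 hkm => ?_, fun i => ?_⟩, hrt, htr, by rw [hη]; linarith,
    hcell⟩
  · refine radius_column_eq ha hcell hr ht he ?_ ?_
      (fun z => (volume_capStrip_eq z 0 t r).trans hcap) hk0 hkm
    · have hrη : 2 * r * (r / (12 * h)) = a / 6 := by
        rw [show 2 * r * (r / (12 * h)) = r ^ 2 / (6 * h) by field_simp; norm_num, hra]
        field_simp
      rw [hη, mul_add, hrη]
      linarith
    · calc Real.pi * (r + (5 * h : ℕ) * (r / (60 * h ^ 2))) ^ 2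
          ≤ 3.15 * (r + r / 12) ^ 2 := by
            rw [hη]
            gcongr
            exact Real.pi_lt_d2.le
        _ < (5 * h : ℕ) * a := by push_cast; nlinarith
  · refine radius_le_of_card_mul_le hinj ha.le hcell (by positivity) ?_ i
    calc (Fintype.card (ColumnIndex (40 * h) (5 * h)) : ℝ) * a ≤ 3 * (5 * r) ^ 2 := by
          simp only [Fintype.card_sum, Fintype.card_fin]
          push_cast
          nlinarith
      _ ≤ Real.pi * (5 * r) ^ 2 := by
          gcongr
          exact Real.pi_gt_three.le

theorem exists_forall_isNotchShape {r t b : ℝ} (hr : 0 < r) (ht : 0 < t) (hb : 0 < b) (q : ℕ) :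
    ∃ x ε : ℝ, (∀ i ≤ q, IsNotchShape (x + i * ε) ε t r) ∧ q * ε < b := by
  have hpos : ∀ᶠ ε in 𝓝[>] (0 : ℝ), 0 < r - (q + 3) * ε :=
    ((Continuous.tendsto (by fun_prop) 0).eventually (lt_mem_nhds (by simpa))).filter_mono
      nhdsWithin_le_nhds
  have hgap : ∀ᶠ ε in 𝓝[>] (0 : ℝ), r ^ 2 < (r - (q + 3) * ε) ^ 2 + (t / 2) ^ 2 :=
    ((Continuous.tendsto (by fun_prop) 0).eventually (lt_mem_nhds (by simp [ht]))).filter_mono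
      nhdsWithin_le_nhds
  have hb' : ∀ᶠ ε in 𝓝[>] (0 : ℝ), q * ε < b :=
    ((Continuous.tendsto (by fun_prop) 0).eventually (gt_mem_nhds (by simpa))).filter_mono
      nhdsWithin_le_nhds
  obtain ⟨ε, hpos, hgap, hb', hε⟩ :=
    (hpos.and (hgap.and (hb'.and self_mem_nhdsWithin))).exists
  refine ⟨r - (q + 2) * ε, ε, fun i hi => ?_, hb'⟩
  have hε : 0 < ε := hε
  have hi : i * ε ≤ q * ε := by gcongr
  have hi0 : 0 ≤ i * ε := by positivity
  have hx : r - (q + 3) * ε ≤ r - (q + 2) * ε + i * ε - ε := by linarith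
  exact ⟨hε, ht, hpos.trans_le hx, by linarith, hgap.trans_le (by gcongr)⟩

theorem exists_isNotchGrid {h q : ℕ} (hh : 0 < h) (hq : 16000 * h ≤ q) {a : ℝ} (ha : 0 < a) :
    ∃ (s : ColumnIndex (40 * h) (5 * h) ⊕ Fin q → Plane)
      (ρ : ColumnIndex (40 * h) (5 * h) ⊕ Fin q → ℝ), Function.Injective s ∧
      (∀ o, volume (openCell s ρ o) = ENNReal.ofReal a) ∧
      ∃ A P x ε y t r Y, IsNotchGrid s ρ A P (5000 * h) (10 * h) x ε y t r Y := by
  have hh1 : (1 : ℝ) ≤ h := by exact_mod_cast hh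
  have hq0 : (0 : ℝ) < q := by exact_mod_cast (by omega : 0 < q)
  have : NeZero q := ⟨by omega⟩
  obtain ⟨r, hr, hra⟩ : ∃ r : ℝ, 0 < r ∧ r ^ 2 = h * a :=
    ⟨_, Real.sqrt_pos.2 (by positivity), Real.sq_sqrt (by positivity)⟩
  obtain ⟨t, e, ρ₁, hcolumn, hrt, htr, hη, hcell₁⟩ := exists_isRegularColumn hh ha hr hra
  obtain ⟨x, ε, hshape, hqε⟩ :=
    exists_forall_isNotchShape (b := a / (160 * r)) hr hcolumn.t_pos (by positivity) q
  have hx : ε < x := by simpa using (hshape 0 q.zero_le).pos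
  have hε := (hshape 0 q.zero_le).ε_pos
  have hxq := (hshape q le_rfl).lt
  set Y := ((40 * h : ℕ) : ℝ) * t + 12 * r with hY
  have hYsep : ((40 * h : ℕ) : ℝ) * t + (5 * h : ℕ) * e + 2 * (5 * r) < Y := by linarith
  obtain ⟨ρ₂, hcell, hradius⟩ := exists_radii_row (D := 40 * r) (M := 5300 * h) ha hcell₁
    (fun i p hp => hcolumn.dist_columnSite_lt_dist_rowSite (q := q) (x := x) (ε := ε) hYsep hp)
    hε (by positivity) (by rw [lt_div_iff₀ (by positivity)] at hqε; linarith)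
    (calc Real.pi * (40 * r + q * ε) ^ 2 ≤ 3.15 * (40 * r + r) ^ 2 := by
            gcongr
            · exact Real.pi_lt_d2.le
            · linarith
      _ < (5300 * h : ℕ) * a := by push_cast; nlinarith)
  have hY39 : Y ≤ 39 * r := by
    rw [hY]
    push_cast
    linarith
  have hY0 : 0 ≤ Y := by
    have := hcolumn.t_pos
    positivity
  have hY40 : r ^ 2 + Y ^ 2 < (40 * r) ^ 2 := by
    nlinarith [pow_le_pow_left₀ hY0 hY39 2, sq_pos_of_pos hr]
  refine ⟨_, _, hcolumn.injective_elim hε (by linarith), hcell, _, _, _, ε, _, t, r, Y,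
    hcolumn.isNotchGrid_elim (k₀ := 15 * h) hYsep (by omega) (by omega) ?_ ?_ (by omega) hshape
      hradius fun p hp0 hp1 => dist_rowSite_lt (by linarith) hε.le (by linarith) (by positivity)
        hY40 hp0 ⟨hp1.1, hp1.2.trans (by linarith)⟩⟩
  · push_cast
    linarith
  · push_cast
    linarith

end Constants

theorem ofReal_le_encard {α : Type*} {S : Set α} {k : ℕ} (h : (k : ℕ∞) ≤ S.encard) {x : ℝ}
    (hx : x ≤ k) : ENNReal.ofReal x ≤ (S.encard : ℝ≥0∞) :=
  calc ENNReal.ofReal x ≤ ENNReal.ofReal k := ENNReal.ofReal_le_ofReal hx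
    _ = ((k : ℕ∞) : ℝ≥0∞) := by simp
    _ ≤ S.encard := ENat.toENNReal_le.2 h

theorem mainTheorem2 :
    ∃ c : ℝ, 0 < c ∧ ∃ N : ℕ, ∀ n : ℕ, N ≤ n → ∀ a : ℝ, 0 < a →
      ∃ (s : Fin n → Plane) (C : Option (Fin n) → Set Plane),
        Function.Injective s ∧
        IsStableMatchingVoronoi s (fun _ => a) C ∧
        ENNReal.ofReal (c * (n : ℝ) ^ 2) ≤ ((cellFaces C).encard : ℝ≥0∞) ∧
        ENNReal.ofReal (c * (n : ℝ) ^ 2) ≤ ((edges C).encard : ℝ≥0∞) ∧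
        ENNReal.ofReal (c * (n : ℝ) ^ 2) ≤ ((vertices C).encard : ℝ≥0∞) := by
  refine ⟨1 / 10 ^ 5, by norm_num, 20000, fun n hn a ha => ?_⟩
  obtain ⟨h, hh⟩ : ∃ h, h = n / 20000 := ⟨_, rfl⟩
  obtain ⟨q, hq⟩ : ∃ q, n = 40 * h + 1 + (5 * h + 5 * h) + q := Nat.exists_eq_add_of_le (by omega)
  obtain ⟨s, ρ, hs, harea, A, P, x, ε, y, t, r, Y, hgrid⟩ :=
    exists_isNotchGrid (q := q) (by omega : 0 < h) (by omega) ha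
  have f : Fin n ≃ ColumnIndex (40 * h) (5 * h) ⊕ Fin q :=
    Fintype.equivOfCardEq (by simp [hq])
  have hf : Function.Surjective (Option.map f) := f.optionCongr.surjective
  have hcount : 1 / 10 ^ 5 * (n : ℝ) ^ 2 ≤ ((5000 * h * (10 * h) : ℕ) : ℝ) := by
    have hn_le : (n : ℝ) ≤ 40000 * h := by exact_mod_cast (by omega : n ≤ 40000 * h)
    push_cast
    nlinarith [pow_le_pow_left₀ n.cast_nonneg hn_le 2]
  refine ⟨s ∘ f, radiiDiagram (s ∘ f) (ρ ∘ f), hs.comp f.injective,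
    isStableMatchingVoronoi_radiiDiagram (hs.comp f.injective) fun i => ?_, ?_⟩
  · rw [openCell_comp_equiv, harea]
  rw [radiiDiagram_comp_equiv, cellFaces_comp_map f.surjective, edges_comp hf, vertices_comp hf]
  exact ⟨ofReal_le_encard hgrid.mul_le_encard_cellFaces hcount,
    ofReal_le_encard hgrid.mul_le_encard_edges hcount,
    ofReal_le_encard hgrid.mul_le_encard_vertices hcount⟩
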